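/- Throughout, $G$ is a locally compact second countable Hausdorff (lcsc) group. **Approximate lattices.** A subset $\Lambda\subset G$ is an *approximate subgroup* if $\Lambda=\Lambda^{-1}$, $e\in\Lambda$ and $\Lambda^2\subset\Lambda F$ for some finite $F\subset\Lambda^\infty$, where $\Lambda^\infty$ is the subgroup of $G$ generated by $\Lambda$. It is a *uniform approximate lattice* if moreover it is a Delone set, i.e. for some left-invariant proper metric $d$ inducing the topology of $G$ there are $R>r>0$ such that $d(x,y)\ge r$ for all distinct $x,y\in\Lambda$, and every $x\in G$ has some $y\in\Lambda$ with $d(x,y)\le R$. Let $\mathcal C(G)$ be the space of closed subsets of $G$ with the Chabauty–Fell topology, generated by the sets $\{P: P\cap K=\emptyset\}$ ($K\subset G$ compact) and $\{P:P\cap V\ne\emptyset\}$ ($V\subset G$ open), on which $G$ acts by left translation. The *hull* of $\Lambda$ is $X_\Lambda=\overline{G.\Lambda}\subset\mathcal C(G)$. A uniform approximate lattice $\Lambda$ is *strong* if $X_\Lambda$ carries a $G$-invariant Borel probability measure. **Haagerup-type properties.** Let $p\in(1,\infty)$. An *$L^p$-space* is a real Banach space $E$ isometrically isomorphic to $L^p(Y,\mu)$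 for some $\sigma$-finite Borel measure $\mu$ on a standard Borel space $Y$; $O(E)$ is its group of surjective linear isometries, with the Borel structure of the strong operator topology. Let $\Gamma$ be an lcsc group and consider maps $\pi:\Gamma\to O(E)$, $b:\Gamma\to E$. - $b$ is an *$L^p$-cocycle* if, for some homomorphism $\pi$ with continuous orbit maps, $b$ is continuous and $b(gh)=b(g)+\pi(g)b(h)$ for all $g,h\in\Gamma$. - $b$ is a *weak $L^p$-quasi-cocycle* if $b$ is Borel and, for some Borel map $\pi$ (not necessarily a homomorphism), $\sup_{g,h\in\Gamma}\|b(gh)-b(g)-\pi(g)b(h)\|<\infty$. - $b$ is an *$L^p$-quasi-cocycle* if, in the preceding item, $\pi$ can be chosen to be a homomorphism. For $A\subset\Gamma$, the map $b$ is *$A$-proper* if $\{g\in A:\|b(g)\|\le C\}$ is relatively compact in $\Gamma$ for every $C>0$. The group $\Gamma$ is *a-F$L^p$-menable* (resp. *a-FF$L^p$-menable*, *a-FFF$L^p$-menable*) *relative to $A$* if there is an $A$-proper $L^p$-cocycle (resp. $L^p$-quasi-cocycle, weak $L^p$-quasi-cocycle) on $\Gamma$ with values in some $L^p$-space; if $A=\Gamma$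 one omits "relative to $A$". For an approximate subgroup $\Sigma\subset G$, the approximate group $(\Sigma,\Sigma^\infty)$ has one of these properties if $\Sigma^\infty$, as a discrete group, has it relative to $\Sigma$. **Theorem 1.1.** Let $p\in(1,\infty)$ and let $\mathcal H$ be one of the properties a-F$L^p$-menability, a-FF$L^p$-menability or a-FFF$L^p$-menability. Let $\Sigma\subset G$ be a uniform approximate lattice which is contained in a strong uniform approximate lattice $\Lambda\subset G$. Then $G$ has $\mathcal H$ if and only if $(\Sigma,\Sigma^\infty)$ has $\mathcal H$. -/

import Mathlib

open MeasureTheory Set Topology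
open scoped Pointwise ENNReal

universe u

namespace ApproxLattice

/-! ### Approximate subgroups and uniform approximate lattices -/

/-- A subset `Λ` of a group is an approximate subgroup if it is symmetric, contains the identity
and satisfies `Λ² ⊆ Λ F` for some finite subset `F` of the group generated by `Λ`. -/
structure IsApproxSubgroup {G : Type u} [Group G] (Λ : Set G) : Prop where
  inv_eq : Λ⁻¹ = Λ
  one_mem : (1 : G) ∈ Λ
  exists_finite : ∃ F : Set G, F.Finite ∧ F ⊆ (Subgroup.closure Λ : Set G) ∧ Λ * Λ ⊆ Λ * F

/-- A left-admissible metric on a topological group: a left-invariant proper metric that induces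
the given topology. -/
structure IsLeftAdmissible {G : Type u} [Group G] [t : TopologicalSpace G]
    (d : MetricSpace G) : Prop where
  topology_eq : d.toPseudoMetricSpace.toUniformSpace.toTopologicalSpace = t
  proper : @ProperSpace G d.toPseudoMetricSpace
  left_invariant : ∀ g x y : G, d.dist (g * x) (g * y) = d.dist x y

/-- A Delone subset of a topological group: `r`-uniformly discrete and `R`-relatively dense
for some `R > r > 0`, with respect to some left-admissible metric. -/
def IsDelone {G : Type u} [Group G] [TopologicalSpace G] (Λ : Set G) : Prop :=
  ∃ d : MetricSpace G, IsLeftAdmissible d ∧ ∃ r R : ℝ, 0 < r ∧ r < R ∧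
    (∀ x ∈ Λ, ∀ y ∈ Λ, x ≠ y → r ≤ d.dist x y) ∧
    (∀ x : G, ∃ y ∈ Λ, d.dist x y ≤ R)

/-- A uniform approximate lattice: an approximate subgroup that is a Delone set. -/
structure IsUniformApproxLattice {G : Type u} [Group G] [TopologicalSpace G]
    (Λ : Set G) : Prop where
  approxSubgroup : IsApproxSubgroup Λ
  delone : IsDelone Λ

/-! ### The Chabauty-Fell space and the hull -/

/-- The collection `𝒞(G)` of closed subsets of `G`, as a type of its own so that it can carry the
Chabauty-Fell topology. -/
@[ext]
structure ClosedSubsets (G : Type u) [TopologicalSpace G] : Type u where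
  toSet : Set G
  isClosed : IsClosed toSet

namespace ClosedSubsets

variable {G : Type u} [TopologicalSpace G]

/-- The Chabauty-Fell topology: it is generated by the sets `{P | P ∩ K = ∅}`, `K` compact, and
`{P | P ∩ V ≠ ∅}`, `V` open. -/
instance : TopologicalSpace (ClosedSubsets G) :=
  TopologicalSpace.generateFrom
    ({U | ∃ K : Set G, IsCompact K ∧ U = {P : ClosedSubsets G | P.toSet ∩ K = ∅}} ∪
      {U | ∃ V : Set G, IsOpen V ∧ U = {P : ClosedSubsets G | (P.toSet ∩ V).Nonempty}})

instance : MeasurableSpace (ClosedSubsets G) := borel _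

instance : BorelSpace (ClosedSubsets G) := ⟨rfl⟩

/-- Left translation `P ↦ gP` on closed subsets. -/
def translate [Group G] [IsTopologicalGroup G] (g : G) (P : ClosedSubsets G) : ClosedSubsets G :=
  ⟨g • P.toSet, P.isClosed.smul g⟩

end ClosedSubsets

/-- The hull of `Λ`: the closure of the orbit `G.Λ` in `𝒞(G)`, the orbit consisting of those
closed sets that are left translates of `Λ`. (Delone sets are closed.) -/
def hull {G : Type u} [Group G] [TopologicalSpace G] (Λ : Set G) : Set (ClosedSubsets G) :=
  closure {P | ∃ g : G, P.toSet = g • Λ}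

/-- A strong uniform approximate lattice: the hull carries a `G`-invariant Borel probability
measure. Such a measure is regarded as an invariant Borel probability measure on `𝒞(G)`
that is concentrated on the (closed, translation invariant) hull. -/
structure IsStrongUniformApproxLattice {G : Type u} [Group G] [TopologicalSpace G]
    [IsTopologicalGroup G] (Λ : Set G) : Prop where
  uniform : IsUniformApproxLattice Λ
  exists_measure : ∃ ν : Measure (ClosedSubsets G), IsProbabilityMeasure ν ∧
    ν (hull Λ)ᶜ = 0 ∧ ∀ g : G, MeasurePreserving (ClosedSubsets.translate g) ν ν

/-! ### `L^p`-spaces, cocycles and their weakenings -/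

/-- `E` is an `L^p`-space: it is isometrically isomorphic to the real space `L^p(Y, μ)` of some
`σ`-finite Borel measure `μ` on a standard Borel space `Y`. -/
def IsLpSpace (p : ℝ≥0∞) (E : Type u) [NormedAddCommGroup E] [NormedSpace ℝ E] : Prop :=
  ∃ (Y : Type u) (_ : MeasurableSpace Y) (_ : StandardBorelSpace Y) (μ : Measure Y)
    (_ : SigmaFinite μ) (e : E ≃ₗ[ℝ] Lp ℝ p μ), ∀ v : E, ‖e v‖ = ‖v‖

section Cocycles

variable {G : Type u} [Group G] [TopologicalSpace G]
  {E : Type u} [NormedAddCommGroup E] [NormedSpace ℝ E]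

/-- The strong operator topology on the orthogonal group `O(E)` of linear isometries of `E`
onto itself, i.e. the topology of pointwise convergence. -/
@[reducible] def strongOperatorTopology (E : Type u) [NormedAddCommGroup E] [NormedSpace ℝ E] :
    TopologicalSpace (E ≃ₗᵢ[ℝ] E) :=
  TopologicalSpace.induced (fun T : E ≃ₗᵢ[ℝ] E => (T : E → E)) Pi.topologicalSpace

/-- `π : G → O(E)` is a Borel map, where `O(E)` carries the Borel structure of the strong operator
topology. -/
def IsBorelMap (π : G → (E ≃ₗᵢ[ℝ] E)) : Prop :=
  @Measurable G (E ≃ₗᵢ[ℝ] E) (borel G) (@borel _ (strongOperatorTopology E)) π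

/-- `(π, b)` is a continuous affine isometric action: `π : G → O(E)` is a homomorphism with
continuous orbit maps, and `b` is a continuous `1`-cocycle with respect to `π`. -/
structure IsCocyclePair (π : G → (E ≃ₗᵢ[ℝ] E)) (b : G → E) : Prop where
  map_mul : ∀ g h : G, π (g * h) = π g * π h
  continuous_rep : ∀ v : E, Continuous fun g => π g v
  continuous_cocycle : Continuous b
  cocycle : ∀ g h : G, b (g * h) = b g + π g (b h)

/-- `(π, b)` is a wq-pair: `π` and `b` are Borel maps, `π` is not necessarily a homomorphism, and
`b` satisfies the cocycle identity with respect to `π` up to a uniformly bounded error. -/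
structure IsWQPair (π : G → (E ≃ₗᵢ[ℝ] E)) (b : G → E) : Prop where
  borel_rep : IsBorelMap π
  borel_cocycle : @Measurable G E (borel G) (borel E) b
  bounded_defect : ∃ D : ℝ, ∀ g h : G, ‖b (g * h) - b g - π g (b h)‖ ≤ D

/-- `(π, b)` is a quasi-pair: a wq-pair in which `π` is a homomorphism. -/
structure IsQuasiPair (π : G → (E ≃ₗᵢ[ℝ] E)) (b : G → E) : Prop extends IsWQPair π b where
  map_mul : ∀ g h : G, π (g * h) = π g * π h

/-- `b : G → E` is `A`-proper: the sets `{g ∈ A | ‖b g‖ ≤ C}` are relatively compact in `G`. -/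
def IsProperOn (A : Set G) (b : G → E) : Prop :=
  ∀ C : ℝ, 0 < C → IsCompact (closure {g | g ∈ A ∧ ‖b g‖ ≤ C})

end Cocycles

/-! ### Haagerup-type properties -/

/-- The three families of Haagerup-type properties: a-FL^p-menability, a-FFL^p-menability and
a-FFFL^p-menability. -/
inductive HaagerupType : Type
  | aFLp
  | aFFLp
  | aFFFLp

/-- The kind of pair `(π, b)` that a Haagerup-type property asks for: an affine isometric action,
a quasi-pair, or a wq-pair. -/
def HaagerupType.IsPair (𝓗 : HaagerupType) {G : Type u} [Group G] [TopologicalSpace G]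
    {E : Type u} [NormedAddCommGroup E] [NormedSpace ℝ E]
    (π : G → (E ≃ₗᵢ[ℝ] E)) (b : G → E) : Prop :=
  match 𝓗 with
  | .aFLp => IsCocyclePair π b
  | .aFFLp => IsQuasiPair π b
  | .aFFFLp => IsWQPair π b

/-- The topological group `G` has the Haagerup-type property `𝓗` with exponent `p` relative to the
subset `A`: there is an `A`-proper cocycle (quasi-cocycle, weak quasi-cocycle) on `G` with values
in an `L^p`-space. Standard Borel spaces have at most continuum many points, so restricting
`L^p`-spaces to the universe of `G` is no loss of generality. -/
def HasRelative (𝓗 : HaagerupType) (p : ℝ≥0∞) (G : Type u) [Group G] [TopologicalSpace G]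
    (A : Set G) : Prop :=
  ∃ (E : Type u) (_ : NormedAddCommGroup E) (_ : NormedSpace ℝ E), IsLpSpace p E ∧
    ∃ (π : G → (E ≃ₗᵢ[ℝ] E)) (b : G → E), 𝓗.IsPair π b ∧ IsProperOn A b

/-- The topological group `G` has the Haagerup-type property `𝓗` with exponent `p`. -/
def Has (𝓗 : HaagerupType) (p : ℝ≥0∞) (G : Type u) [Group G] [TopologicalSpace G] : Prop :=
  HasRelative 𝓗 p G Set.univ

/-- For an approximate subgroup `Λ`, the approximate group `(Λ, Λ^∞)` has the Haagerup-type
property `𝓗` with exponent `p` if `Λ^∞` has it relative to `Λ`. Here `Λ^∞` is the group generated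
by `Λ`, with the discrete topology `⊥` (not the subspace topology). -/
def ApproxGroupHas (𝓗 : HaagerupType) (p : ℝ≥0∞) {G : Type u} [Group G] (Λ : Set G) : Prop :=
  @HasRelative 𝓗 p (Subgroup.closure Λ) _ ⊥ {γ | (γ : G) ∈ Λ}

end ApproxLattice

/-! From `G` to `S` one restricts: a Delone set meets compact sets in finite sets, so a proper `b`
on `G` is still proper on `S` inside the discrete group generated by `S` (`approxGroupHas_of_has`).

Conversely, write `Γ` for the group generated by `S`. One induces from `Γ` to `G` as from a
cocompact lattice, the hull of `L` taking the place of `G/Γ`. Two points of an element `P` of the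
hull differ by an element of `L²`, but this need not lie in `Γ`. So `P` is split into classes modulo
`Γ`, and only the classes that hit every translate of a fixed compact set `K` are kept. There is at
least one (`exists_relativelyDense_classOf`): if `P` is a limit of translates of `L`, the same
translates of `S` accumulate at a relatively dense subset of a single class. There are boundedly
many, since each is identified by a point in one of finitely many small cells covering `K`. Counting
these classes and integrating against the invariant measure of the hull gives a finite nonzero
invariant measure `m` on the space of patterns (`exists_invariant_measure_pattern`).

A measurable choice `s Q ∈ Q` of a point in a fixed compact set `C` yields the return cocycle `c g Q
= (s Q)⁻¹ * g * s (g⁻¹ • Q)` with values in `L² ∩ Γ` (`Pattern.exists_isInducingCocycle`). For `g`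
in a compact set it takes finitely many values; a value in a finite set `T` forces `g ∈ C T C⁻¹`;
and for `g` near `g₀` it differs from `c g₀` only on a set of small measure.

Given `(π, b)` on `Γ`, put `(π̃ g f)(y) = π (c g y) (f (g⁻¹ • y))` and `b̃ g y = b (c g y)` on
`L^p(m; E)`. The defect of `b̃` is pointwise a defect of `b`, and local finiteness of the values of
`c` makes `π̃` strongly continuous and `b̃` continuous, whatever the regularity of `π` and `b`.
Properness passes from `S` to `L² ∩ Γ ⊆ S F` with `F` finite, and then to `b̃` because `m` has
positive mass. Finally `L^p(m; E)` is again an `L^p`-space (`IsLpSpace.Lp`) by Tonelli's theorem. -/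

namespace ApproxLattice

/-! ### Locally finite subsets of groups -/

/-- A subset of a topological space is locally finite if it meets every compact set in a
finite set. -/
def LocFin {X : Type*} [TopologicalSpace X] (D : Set X) : Prop :=
  ∀ K : Set X, IsCompact K → (D ∩ K).Finite

namespace LocFin

variable {G : Type*} [TopologicalSpace G] {D E : Set G}

theorem mono (hD : LocFin D) (h : E ⊆ D) : LocFin E := fun K hK =>
  (hD K hK).subset (inter_subset_inter_left _ h)

theorem isClosed [T2Space G] [LocallyCompactSpace G] (hD : LocFin D) : IsClosed D := by
  rw [← isOpen_compl_iff, isOpen_iff_mem_nhds]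
  intro x hx
  obtain ⟨N, hN, hxN⟩ := exists_compact_mem_nhds x
  have h1 : IsClosed (D ∩ N) := (hD N hN).isClosed
  have h2 : (D ∩ N)ᶜ ∈ 𝓝 x := h1.isOpen_compl.mem_nhds fun h => hx h.1
  filter_upwards [hxN, h2] with y hy1 hy2 hy3
  exact hy2 ⟨hy3, hy1⟩

theorem iUnion_finite {ι : Type*} {s : Set ι} (hs : s.Finite) {f : ι → Set G}
    (h : ∀ i ∈ s, LocFin (f i)) : LocFin (⋃ i ∈ s, f i) := by
  intro K hK
  rw [iUnion₂_inter]
  exact hs.biUnion fun i hi => h i hi K hK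

/-- Used with sets of quotients such as `L * L`: two points in a common cell whose quotients lie in
`U` must coincide. -/
theorem exists_nhds_one [One G] [T2Space G] [LocallyCompactSpace G] (hD : LocFin D) :
    ∃ U ∈ 𝓝 (1 : G), ∀ x ∈ D, x ∈ U → x = 1 := by
  refine ⟨(D \ {1})ᶜ, (hD.mono sdiff_subset).isClosed.isOpen_compl.mem_nhds fun h => h.2 rfl, ?_⟩
  intro x hx hxU
  by_contra h
  exact hxU ⟨hx, h⟩

variable [Group G] [IsTopologicalGroup G]

theorem mul_finite (hD : LocFin D) {F : Set G} (hF : F.Finite) : LocFin (D * F) := by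
  rw [← iUnion_mul_right_image]
  refine iUnion_finite hF fun f _ K hK => ?_
  have h1 : IsCompact ((fun x => x * f) ⁻¹' K) := (Homeomorph.mulRight f).isCompact_preimage.2 hK
  refine ((hD _ h1).image (fun x => x * f)).subset ?_
  rintro _ ⟨⟨x, hx, rfl⟩, hxK⟩
  exact ⟨x, ⟨hx, hxK⟩, rfl⟩

end LocFin

/-- A compact set is covered by finitely many compact sets with small quotients. -/
theorem exists_small_compact_cover {G : Type*} [Group G] [TopologicalSpace G]
    [IsTopologicalGroup G] [LocallyCompactSpace G] {K U : Set G} (hK : IsCompact K)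
    (hU : U ∈ 𝓝 (1 : G)) :
    ∃ (n : ℕ) (C : Fin n → Set G), (∀ i, IsCompact (C i)) ∧ K ⊆ ⋃ i, C i ∧
      ∀ i, ∀ x ∈ C i, ∀ y ∈ C i, x⁻¹ * y ∈ U := by
  have h1 : Filter.Tendsto (fun p : G × G => p.1⁻¹ * p.2) (𝓝 (1, 1)) (𝓝 1) := by
    have : Continuous (fun p : G × G => p.1⁻¹ * p.2) := by fun_prop
    simpa using this.tendsto (1, 1)
  have h2 := h1 hU
  rw [Filter.mem_map, mem_nhds_prod_iff] at h2
  obtain ⟨A, hA, B, hB, hAB⟩ := h2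
  -- Left translates of `N` have the same quotients as `N`, so one compact `N` with `N⁻¹N ⊆ U`
  -- serves all cells.
  obtain ⟨N, hN, hNsub, hNc⟩ := local_compact_nhds (Filter.inter_mem hA hB)
  obtain ⟨t, ht⟩ := hK.elim_nhds_subcover (fun x => x • N) fun x _ => by
    simpa using smul_mem_nhds_smul x hN
  refine ⟨t.card, fun i => ((t.equivFin.symm i : t) : G) • N, fun i => hNc.smul _, ?_, ?_⟩
  · intro x hx
    obtain ⟨y, hy, hxy⟩ := mem_iUnion₂.1 (ht.2 hx)
    exact mem_iUnion.2 ⟨t.equivFin ⟨y, hy⟩, by simpa using hxy⟩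
  · rintro i _ ⟨x, hx, rfl⟩ _ ⟨y, hy, rfl⟩
    have : (x, y) ∈ A ×ˢ B := ⟨(hNsub hx).1, (hNsub hy).2⟩
    simpa [mul_assoc] using hAB this

/-! ### Delone sets: local finiteness and relative density -/

section Delone

variable {G : Type u} [Group G] [t : TopologicalSpace G] [IsTopologicalGroup G]

/-- Cells whose quotients have length less than `r` contain at most one point of `D`, and finitely
many of them cover a compact set. -/
theorem IsDelone.locFin [LocallyCompactSpace G] {D : Set G} (hD : IsDelone D) : LocFin D := by
  obtain ⟨d, hd, r, R, hr, -, hud, -⟩ := hD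
  have hball : {x : G | d.dist 1 x < r} ∈ 𝓝 (1 : G) := by
    obtain ⟨h1, -, -⟩ := hd
    subst h1
    filter_upwards [Metric.ball_mem_nhds (1 : G) hr] with x hx
    rwa [Metric.mem_ball, dist_comm] at hx
  intro K hK
  obtain ⟨n, C, -, hKC, hC⟩ := exists_small_compact_cover hK hball
  refine (Set.finite_iUnion (f := fun i => D ∩ C i) fun i => ?_).subset ?_
  · refine Set.Subsingleton.finite ?_
    rintro x ⟨hx, hxC⟩ y ⟨hy, hyC⟩
    by_contra hne
    have h1 := hud x hx y hy hne
    have h2 : d.dist 1 (x⁻¹ * y) < r := hC i x hxC y hyC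
    have h3 := hd.left_invariant x⁻¹ x y
    rw [inv_mul_cancel] at h3
    linarith
  · rintro x ⟨hx, hxK⟩
    obtain ⟨i, hi⟩ := mem_iUnion.1 (hKC hxK)
    exact mem_iUnion.2 ⟨i, hx, hi⟩

theorem IsDelone.exists_compact {D : Set G} (hD : IsDelone D) :
    ∃ K : Set G, IsCompact K ∧ ∀ g : G, (D ∩ g • K).Nonempty := by
  obtain ⟨d, hd, r, R, hr, -, -, hrd⟩ := hD
  refine ⟨{x : G | d.dist 1 x ≤ R}, ?_, fun g => ?_⟩
  · obtain ⟨h1, h2, -⟩ := hd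
    subst h1
    have : {x : G | dist 1 x ≤ R} = Metric.closedBall 1 R := by
      ext x
      simp [dist_comm]
    exact this ▸ isCompact_closedBall _ _
  · obtain ⟨y, hy, hgy⟩ := hrd g
    refine ⟨y, hy, ?_⟩
    rw [mem_smul_set_iff_inv_smul_mem, smul_eq_mul, mem_ofPred_eq]
    have h3 := hd.left_invariant g⁻¹ g y
    rw [inv_mul_cancel] at h3
    rwa [h3]

end Delone

/-! ### Powers of locally finite approximate subgroups -/

section ApproxSubgroup

variable {G : Type u} [Group G] {L S : Set G}

theorem IsApproxSubgroup.inv_mem (hL : IsApproxSubgroup L) {x : G} (hx : x ∈ L) : x⁻¹ ∈ L := by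
  rw [← hL.inv_eq]
  simpa using hx

variable [TopologicalSpace G] [IsTopologicalGroup G]

theorem IsApproxSubgroup.locFin_sq (hL : IsApproxSubgroup L) (h : LocFin L) : LocFin (L * L) := by
  obtain ⟨F, hF, -, hLF⟩ := hL.exists_finite
  exact (h.mul_finite hF).mono hLF

theorem IsApproxSubgroup.locFin_cube (hL : IsApproxSubgroup L) (h : LocFin L) :
    LocFin (L * (L * L)) := by
  obtain ⟨F, hF, -, hLF⟩ := hL.exists_finite
  refine ((hL.locFin_sq h).mul_finite hF).mono ?_
  rw [mul_assoc]
  exact mul_subset_mul_left hLF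

/-- If `S ⊆ L` is relatively dense, then the part of `L²` in the group generated by `S` lies
in finitely many translates of `S`. -/
theorem IsApproxSubgroup.exists_finite_sq_inter_closure_subset (hL : IsApproxSubgroup L)
    (h : LocFin L) (hS : IsApproxSubgroup S) (hSL : S ⊆ L) {K : Set G} (hK : IsCompact K)
    (hSK : ∀ g : G, (S ∩ g • K).Nonempty) :
    ∃ F : Set G, F.Finite ∧ F ⊆ Subgroup.closure S ∧ (L * L) ∩ Subgroup.closure S ⊆ S * F := by
  -- For `x` in `L²` and `s ∈ S ∩ xK`, the remainder `s⁻¹x` lies in `L³ ∩ K⁻¹`, which is finite.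
  refine ⟨(L * (L * L) ∩ K⁻¹) ∩ Subgroup.closure S,
    (hL.locFin_cube h _ hK.inv).inter_of_left _, inter_subset_right, ?_⟩
  rintro x ⟨hx, hxS⟩
  obtain ⟨s, hs, hsK⟩ := hSK x
  rw [mem_smul_set_iff_inv_smul_mem, smul_eq_mul] at hsK
  refine ⟨s, hs, s⁻¹ * x, ⟨⟨?_, ?_⟩, ?_⟩, by simp⟩
  · exact mul_mem_mul (hSL (hS.inv_mem hs)) hx
  · simpa using hsK
  · exact (Subgroup.closure S).mul_mem
      ((Subgroup.closure S).inv_mem (Subgroup.subset_closure hs)) hxS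

end ApproxSubgroup

/-! ### The hull -/

section Hull

variable {G : Type u} [TopologicalSpace G]

theorem ClosedSubsets.isOpen_setOf_inter_eq_empty {K : Set G} (hK : IsCompact K) :
    IsOpen {P : ClosedSubsets G | P.toSet ∩ K = ∅} :=
  TopologicalSpace.isOpen_generateFrom_of_mem (Or.inl ⟨K, hK, rfl⟩)

theorem ClosedSubsets.isOpen_setOf_inter_nonempty {V : Set G} (hV : IsOpen V) :
    IsOpen {P : ClosedSubsets G | (P.toSet ∩ V).Nonempty} :=
  TopologicalSpace.isOpen_generateFrom_of_mem (Or.inr ⟨V, hV, rfl⟩)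

theorem ClosedSubsets.isClosed_setOf_inter_nonempty {K : Set G} (hK : IsCompact K) :
    IsClosed {P : ClosedSubsets G | (P.toSet ∩ K).Nonempty} := by
  rw [← isOpen_compl_iff]
  convert ClosedSubsets.isOpen_setOf_inter_eq_empty hK using 1
  ext P
  simp [not_nonempty_iff_eq_empty]

theorem smul_inter_nonempty_iff {G : Type*} [Group G] (g : G) (A B : Set G) :
    (g • A ∩ B).Nonempty ↔ (A ∩ g⁻¹ • B).Nonempty := by
  constructor
  · rintro ⟨_, ⟨x, hx, rfl⟩, hB⟩
    exact ⟨x, hx, by simpa [mem_smul_set_iff_inv_smul_mem] using hB⟩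
  · rintro ⟨x, hx, hB⟩
    exact ⟨g • x, smul_mem_smul_set hx, by simpa [mem_smul_set_iff_inv_smul_mem] using hB⟩

variable [Group G] [IsTopologicalGroup G]

theorem ClosedSubsets.continuous_translate (g : G) :
    Continuous (ClosedSubsets.translate g : ClosedSubsets G → ClosedSubsets G) := by
  refine continuous_generateFrom_iff.2 ?_
  rintro _ (⟨K, hK, rfl⟩ | ⟨V, hV, rfl⟩)
  · convert ClosedSubsets.isOpen_setOf_inter_eq_empty (hK.smul g⁻¹) using 1
    ext P
    have := smul_inter_nonempty_iff g P.toSet K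
    simp only [mem_preimage, mem_ofPred_eq, ClosedSubsets.translate]
    rw [← not_nonempty_iff_eq_empty, ← not_nonempty_iff_eq_empty, this]
  · convert ClosedSubsets.isOpen_setOf_inter_nonempty (hV.smul g⁻¹) using 1
    ext P
    exact smul_inter_nonempty_iff g P.toSet V

theorem translate_mem_hull {L : Set G} {P : ClosedSubsets G} (hP : P ∈ hull L) (g : G) :
    P.translate g ∈ hull L := by
  refine map_mem_closure (ClosedSubsets.continuous_translate g) hP ?_
  rintro Q ⟨h, hQ⟩
  exact ⟨g * h, by simp [ClosedSubsets.translate, hQ, mul_smul]⟩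

/-- For a translate `gL` the `g` cancels in quotients. A quotient outside the closed set `L²` would
persist in nearby translates, because hitting open sets is an open condition. -/
theorem inv_mul_mem_of_mem_hull {L : Set G} (hL : IsApproxSubgroup L) (hLL : IsClosed (L * L))
    {P : ClosedSubsets G} (hP : P ∈ hull L) {x y : G} (hx : x ∈ P.toSet) (hy : y ∈ P.toSet) :
    x⁻¹ * y ∈ L * L := by
  by_contra hxy
  have h1 : Continuous (fun p : G × G => p.1⁻¹ * p.2) := by fun_prop
  obtain ⟨A, B, hA, hB, hxA, hyB, hAB⟩ :=
    isOpen_prod_iff.1 (hLL.isOpen_compl.preimage h1) x y hxy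
  obtain ⟨Q, ⟨hQA, hQB⟩, g, hg⟩ := mem_closure_iff.1 hP _
    ((ClosedSubsets.isOpen_setOf_inter_nonempty hA).inter
      (ClosedSubsets.isOpen_setOf_inter_nonempty hB)) ⟨⟨x, hx, hxA⟩, ⟨y, hy, hyB⟩⟩
  obtain ⟨a, haQ, haA⟩ := hQA
  obtain ⟨b, hbQ, hbB⟩ := hQB
  rw [hg] at haQ hbQ
  obtain ⟨l, hl, rfl⟩ := haQ
  obtain ⟨k, hk, rfl⟩ := hbQ
  refine @hAB (g • l, g • k) ⟨haA, hbB⟩ ?_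
  simpa [mul_assoc] using mul_mem_mul (hL.inv_mem hl) hk

/-- The points of `P` that differ from `x` by an element of `Γ`. -/
def classOf (Γ : Subgroup G) (P : Set G) (x : G) : Set G := {y ∈ P | x⁻¹ * y ∈ Γ}

omit [TopologicalSpace G] [IsTopologicalGroup G] in
theorem classOf_eq_of_mem {Γ : Subgroup G} {P : Set G} {x y : G} (hy : y ∈ classOf Γ P x) :
    classOf Γ P y = classOf Γ P x := by
  ext z
  refine and_congr_right fun _ => ?_
  have : x⁻¹ * z = (x⁻¹ * y) * (y⁻¹ * z) := by group
  rw [this, Γ.mul_mem_cancel_left hy.2]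

omit [TopologicalSpace G] [IsTopologicalGroup G] in
theorem mem_classOf_self {Γ : Subgroup G} {P : Set G} {x : G} (hx : x ∈ P) : x ∈ classOf Γ P x :=
  ⟨hx, by simp⟩

omit [TopologicalSpace G] [IsTopologicalGroup G] in
theorem classOf_smul {Γ : Subgroup G} {P : Set G} (g x : G) :
    classOf Γ (g • P) (g * x) = g • classOf Γ P x := by
  ext y
  simp [classOf, mem_smul_set_iff_inv_smul_mem, mul_assoc]

/-- Every element of the hull of `L` contains a relatively dense class modulo the group
generated by a relatively dense subset `S` of `L`. -/
theorem exists_relativelyDense_classOf [T2Space G] [LocallyCompactSpace G] {L S : Set G}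
    (hLL : LocFin (L * L)) (hS : IsApproxSubgroup S) (hSL : S ⊆ L)
    {K : Set G} (hK : IsCompact K) (hSK : ∀ g : G, (S ∩ g • K).Nonempty)
    {P : ClosedSubsets G} (hP : P ∈ hull L) :
    ∃ x ∈ P.toSet, ∀ g : G,
      (classOf (Subgroup.closure S) P.toSet x ∩ g • K).Nonempty := by
  classical
  obtain ⟨u, hu, huP⟩ := mem_closure_iff_ultrafilter.1 hP
  choose! γ hγ using fun (Q : ClosedSubsets G)
    (hQ : Q ∈ {P : ClosedSubsets G | ∃ g : G, P.toSet = g • L}) => hQ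
  -- The limit along `u` of the translates `γ R • S`, where `γ R • L` converges to `P`. It is
  -- contained in `P`, and its quotients lie in `S²`, so it lies in one class modulo the group
  -- generated by `S`.
  let Q : Set G := {x | ∀ V ∈ 𝓝 x, ∀ᶠ R in (u : Filter (ClosedSubsets G)),
    (γ R • S ∩ V).Nonempty}
  have hQP : Q ⊆ P.toSet := by
    intro x hx
    by_contra hxP
    obtain ⟨V, hVx, hVP, hVc⟩ := local_compact_nhds (P.isClosed.isOpen_compl.mem_nhds hxP)
    have h1 : {R : ClosedSubsets G | R.toSet ∩ V = ∅} ∈ 𝓝 P := by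
      refine (ClosedSubsets.isOpen_setOf_inter_eq_empty hVc).mem_nhds ?_
      exact (disjoint_left.2 fun y hy hyV => hVP hyV hy).inter_eq
    obtain ⟨R, hR1, hR2, hR3⟩ := ((hx V hVx).and (Filter.Eventually.and (huP h1) hu)).exists
    obtain ⟨y, hy, hyV⟩ := hR1
    have : y ∈ R.toSet ∩ V := ⟨by rw [hγ R hR3]; exact smul_set_mono hSL hy, hyV⟩
    rw [hR2] at this
    exact this
  have hSS : IsClosed (S * S) := (hLL.mono (mul_subset_mul hSL hSL)).isClosed
  have hQQ : ∀ x ∈ Q, ∀ y ∈ Q, x⁻¹ * y ∈ S * S := by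
    intro x hx y hy
    by_contra hxy
    have h1 : Continuous (fun p : G × G => p.1⁻¹ * p.2) := by fun_prop
    obtain ⟨A, B, hA, hB, hxA, hyB, hAB⟩ :=
      isOpen_prod_iff.1 (hSS.isOpen_compl.preimage h1) x y hxy
    obtain ⟨R, ⟨a, ha, haA⟩, b, hb, hbB⟩ :=
      ((hx A (hA.mem_nhds hxA)).and (hy B (hB.mem_nhds hyB))).exists
    obtain ⟨l, hl, rfl⟩ := ha
    obtain ⟨k, hk, rfl⟩ := hb
    refine @hAB (γ R • l, γ R • k) ⟨haA, hbB⟩ ?_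
    simpa [mul_assoc] using mul_mem_mul (hS.inv_mem hl) hk
  have hQK : ∀ g : G, (Q ∩ g • K).Nonempty := by
    intro g
    have h1 : ∀ h : G, (h • S ∩ g • K).Nonempty := fun h => by
      rw [smul_inter_nonempty_iff, smul_smul]
      exact hSK _
    choose z hz using h1
    -- Choosing a point of each translate of `S` in the compact set `g • K` and taking its
    -- ultrafilter limit shows that `Q` hits `g • K`.
    have h2 : (u.map fun R => z (γ R) : Filter G) ≤ Filter.principal (g • K) := by
      rw [Filter.le_principal_iff]
      exact Filter.Eventually.of_forall (f := (u : Filter (ClosedSubsets G)))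
        fun R => (hz (γ R)).2
    obtain ⟨x, hxK, hx⟩ := (hK.smul g).ultrafilter_le_nhds (u.map fun R => z (γ R)) h2
    refine ⟨x, fun V hV => ?_, hxK⟩
    have h3 : ∀ᶠ R in (u : Filter (ClosedSubsets G)), z (γ R) ∈ V := hx hV
    filter_upwards [h3] with R hR
    exact ⟨_, (hz _).1, hR⟩
  obtain ⟨x, hx, -⟩ := hQK 1
  refine ⟨x, hQP hx, fun g => (hQK g).mono (inter_subset_inter_left _ fun y hy => ⟨hQP hy, ?_⟩)⟩
  obtain ⟨a, ha, b, hb, hab⟩ := hQQ x hx y hy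
  rw [← hab]
  exact (Subgroup.closure S).mul_mem (Subgroup.subset_closure ha) (Subgroup.subset_closure hb)

end Hull

/-! ### Measurable families of closed sets -/

theorem isSigmaCompact_of_isOpen {X : Type*} [TopologicalSpace X] [LocallyCompactSpace X]
    [SecondCountableTopology X] {V : Set X} (hV : IsOpen V) : IsSigmaCompact V := by
  have := hV.locallyCompactSpace
  exact isSigmaCompact_iff_sigmaCompactSpace.2 inferInstance

theorem isSigmaCompact_inter {X : Type*} [TopologicalSpace X] [T2Space X] {A B : Set X}
    (hA : IsSigmaCompact A) (hB : IsSigmaCompact B) : IsSigmaCompact (A ∩ B) := by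
  obtain ⟨C, hC, rfl⟩ := hA
  obtain ⟨D, hD, rfl⟩ := hB
  rw [iUnion_inter_iUnion]
  exact isSigmaCompact_iUnion _ fun i => isSigmaCompact_iUnion_of_isCompact _ fun j =>
    (hC i).inter (hD j)

/-- A family of sets is hit-measurable if hitting an open or compact set is a measurable event. -/
structure HitMeasurable {Z G : Type*} [MeasurableSpace Z] [TopologicalSpace G]
    (F : Z → Set G) : Prop where
  of_isOpen : ∀ V : Set G, IsOpen V → MeasurableSet {z | (F z ∩ V).Nonempty}
  of_isCompact : ∀ C : Set G, IsCompact C → MeasurableSet {z | (F z ∩ C).Nonempty}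

namespace HitMeasurable

variable {Z G : Type*} [MeasurableSpace Z] [TopologicalSpace G] {F : Z → Set G}

theorem of_isSigmaCompact (hF : HitMeasurable F) {A : Set G} (hA : IsSigmaCompact A) :
    MeasurableSet {z | (F z ∩ A).Nonempty} := by
  obtain ⟨C, hC, rfl⟩ := hA
  simp only [inter_iUnion, nonempty_iUnion, ofPred_exists]
  exact MeasurableSet.iUnion fun i => hF.of_isCompact _ (hC i)

variable [T2Space G] [LocallyCompactSpace G] [SecondCountableTopology G]

/-- For families of closed sets, it is enough to test open sets. -/
theorem of_isClosed (hcl : ∀ z, IsClosed (F z))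
    (hF : ∀ V : Set G, IsOpen V → MeasurableSet {z | (F z ∩ V).Nonempty}) :
    HitMeasurable F := by
  refine ⟨hF, fun C hC => ?_⟩
  let _ := TopologicalSpace.metrizableSpaceMetric G
  -- A closed set that misses the compact set `C` also misses some thickening of it.
  have : {z | (F z ∩ C).Nonempty} =
      ⋂ n : ℕ, {z | (F z ∩ Metric.thickening (1 / ((n : ℝ) + 1)) C).Nonempty} := by
    ext z
    simp only [mem_ofPred_eq, mem_iInter]
    refine ⟨fun h n => h.mono (inter_subset_inter_right _
      (Metric.self_subset_thickening (by positivity) _)), fun h => ?_⟩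
    by_contra hz
    have hd : Disjoint C (F z) := by
      rw [disjoint_iff_inter_eq_empty, inter_comm]
      exact not_nonempty_iff_eq_empty.1 hz
    obtain ⟨δ, hδ, hdis⟩ := hd.exists_thickenings hC (hcl z)
    obtain ⟨n, hn⟩ := exists_nat_one_div_lt hδ
    obtain ⟨x, hx, hxC⟩ := h n
    exact disjoint_left.1 hdis (Metric.thickening_mono hn.le _ hxC)
      (Metric.self_subset_thickening hδ _ hx)
  rw [this]
  exact MeasurableSet.iInter fun n => hF _ Metric.isOpen_thickening

/-- The open condition `y⁻¹ * x ∈ W` is a union of countably many boxes of basic open sets, so the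
event is a countable union of intersections of two hitting events. -/
theorem of_pair [Group G] [IsTopologicalGroup G] (hF : HitMeasurable F) {A B W : Set G}
    (hA : IsSigmaCompact A) (hB : IsSigmaCompact B) (hW : IsOpen W) :
    MeasurableSet {z | ∃ y ∈ F z ∩ A, ∃ x ∈ F z ∩ B, y⁻¹ * x ∈ W} := by
  set b := TopologicalSpace.countableBasis G
  have hb := TopologicalSpace.isBasis_countableBasis G
  set T : Set (Set G × Set G) :=
    {p ∈ b ×ˢ b | ∀ y ∈ p.1, ∀ x ∈ p.2, y⁻¹ * x ∈ W}
  have hT : T.Countable := ((TopologicalSpace.countable_countableBasis G).prod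
    (TopologicalSpace.countable_countableBasis G)).mono (sep_subset _ _)
  have : {z | ∃ y ∈ F z ∩ A, ∃ x ∈ F z ∩ B, y⁻¹ * x ∈ W} =
      ⋃ p ∈ T, {z | (F z ∩ (A ∩ p.1)).Nonempty} ∩ {z | (F z ∩ (B ∩ p.2)).Nonempty} := by
    ext z
    simp only [mem_ofPred_eq, mem_iUnion, mem_inter_iff]
    constructor
    · rintro ⟨y, ⟨hy, hyA⟩, x, ⟨hx, hxB⟩, hyx⟩
      have h1 : Continuous (fun p : G × G => p.1⁻¹ * p.2) := by fun_prop
      obtain ⟨U, V, hU, hV, hyU, hxV, hUV⟩ := isOpen_prod_iff.1 (hW.preimage h1) y x hyx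
      obtain ⟨U', hU', hyU', hUU⟩ := hb.exists_subset_of_mem_open hyU hU
      obtain ⟨V', hV', hxV', hVV⟩ := hb.exists_subset_of_mem_open hxV hV
      exact ⟨(U', V'), ⟨⟨hU', hV'⟩, fun a ha c hc =>
        hUV (show (a, c) ∈ U ×ˢ V from ⟨hUU ha, hVV hc⟩)⟩, ⟨y, hy, hyA, hyU'⟩, ⟨x, hx, hxB, hxV'⟩⟩
    · rintro ⟨p, hp, ⟨y, hy, hyA, hyp⟩, ⟨x, hx, hxB, hxp⟩⟩
      exact ⟨y, ⟨hy, hyA⟩, x, ⟨hx, hxB⟩, hp.2 y hyp x hxp⟩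
  rw [this]
  refine MeasurableSet.biUnion hT fun p hp => ?_
  have h1 := isSigmaCompact_of_isOpen (hb.isOpen hp.1.1)
  have h2 := isSigmaCompact_of_isOpen (hb.isOpen hp.1.2)
  exact (hF.of_isSigmaCompact (isSigmaCompact_inter hA h1)).inter
    (hF.of_isSigmaCompact (isSigmaCompact_inter hB h2))

end HitMeasurable

theorem ClosedSubsets.hitMeasurable {G : Type u} [TopologicalSpace G] :
    HitMeasurable (ClosedSubsets.toSet : ClosedSubsets G → Set G) :=
  ⟨fun _ hV => (ClosedSubsets.isOpen_setOf_inter_nonempty hV).measurableSet,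
    fun _ hC => (ClosedSubsets.isClosed_setOf_inter_nonempty hC).measurableSet⟩

/-! ### Relatively dense patterns -/

/-- A closed subset of `G` with all quotients in `D` that hits all translates of `K`. -/
@[ext]
structure Pattern {G : Type u} [Group G] [TopologicalSpace G] (D K : Set G) : Type u where
  carrier : Set G
  isClosed : IsClosed carrier
  inv_mul_mem : ∀ x ∈ carrier, ∀ y ∈ carrier, x⁻¹ * y ∈ D
  hits : ∀ g : G, (carrier ∩ g • K).Nonempty

namespace Pattern

variable {G : Type u} [Group G] [TopologicalSpace G] {D K : Set G}

/-- The σ-algebra generated by the events of hitting an open set. -/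
instance : MeasurableSpace (Pattern D K) :=
  MeasurableSpace.generateFrom
    {A | ∃ V : Set G, IsOpen V ∧ A = {Q : Pattern D K | (Q.carrier ∩ V).Nonempty}}

theorem measurableSet_hit_of_isOpen {V : Set G} (hV : IsOpen V) :
    MeasurableSet {Q : Pattern D K | (Q.carrier ∩ V).Nonempty} :=
  MeasurableSpace.measurableSet_generateFrom ⟨V, hV, rfl⟩

theorem hitMeasurable [T2Space G] [LocallyCompactSpace G] [SecondCountableTopology G] :
    HitMeasurable (carrier : Pattern D K → Set G) :=
  HitMeasurable.of_isClosed (fun Q => Q.isClosed) fun _ => measurableSet_hit_of_isOpen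

/-- Needed in `IsLpSpace.Lp`, where the pattern space is replaced by a standard Borel space with the
same measurable sets. -/
instance [SecondCountableTopology G] : MeasurableSpace.CountablyGenerated (Pattern D K) := by
  set b := TopologicalSpace.countableBasis G
  have hb := TopologicalSpace.isBasis_countableBasis G
  refine ⟨⟨(fun V => {Q : Pattern D K | (Q.carrier ∩ V).Nonempty}) '' b,
    (TopologicalSpace.countable_countableBasis G).image _, le_antisymm ?_ ?_⟩⟩
  · refine MeasurableSpace.generateFrom_le ?_
    rintro _ ⟨V, hV, rfl⟩
    obtain ⟨S, hS, rfl⟩ := hb.open_eq_sUnion hV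
    simp only [sUnion_eq_biUnion, inter_iUnion, nonempty_iUnion, ofPred_exists]
    refine MeasurableSet.biUnion ((TopologicalSpace.countable_countableBasis G).mono hS)
      fun U hU => ?_
    exact MeasurableSpace.measurableSet_generateFrom ⟨U, hS hU, rfl⟩
  · refine MeasurableSpace.generateFrom_le ?_
    rintro _ ⟨V, hV, rfl⟩
    exact measurableSet_hit_of_isOpen (hb.isOpen hV)

theorem locFin [IsTopologicalGroup G] (hD : LocFin D) (Q : Pattern D K) : LocFin Q.carrier := by
  intro C hC
  obtain ⟨x, hx, -⟩ := Q.hits 1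
  refine ((hD _ (hC.smul x⁻¹)).image (fun z => x * z)).subset ?_
  rintro y ⟨hy, hyC⟩
  exact ⟨x⁻¹ * y, ⟨Q.inv_mul_mem x hx y hy, y, hyC, rfl⟩, by simp⟩

variable [IsTopologicalGroup G]

/-- Patterns are permuted by left translations. -/
instance : SMul G (Pattern D K) where
  smul g Q :=
    { carrier := g • Q.carrier
      isClosed := Q.isClosed.smul g
      inv_mul_mem := by
        rintro _ ⟨x, hx, rfl⟩ _ ⟨y, hy, rfl⟩
        simpa [mul_assoc] using Q.inv_mul_mem x hx y hy
      hits := fun h => by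
        rw [smul_inter_nonempty_iff, smul_smul]
        exact Q.hits _ }

@[simp]
theorem carrier_smul (g : G) (Q : Pattern D K) : (g • Q).carrier = g • Q.carrier := rfl

instance : MulAction G (Pattern D K) where
  one_smul Q := Pattern.ext (one_smul G Q.carrier)
  mul_smul g h Q := Pattern.ext (mul_smul g h Q.carrier)

theorem measurable_smul (g : G) : Measurable fun Q : Pattern D K => g • Q := by
  refine measurable_generateFrom ?_
  rintro _ ⟨V, hV, rfl⟩
  have : (fun Q : Pattern D K => g • Q) ⁻¹' {Q | (Q.carrier ∩ V).Nonempty} =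
      {Q | (Q.carrier ∩ g⁻¹ • V).Nonempty} := by
    ext Q
    exact smul_inter_nonempty_iff g Q.carrier V
  rw [this]
  exact measurableSet_hit_of_isOpen (hV.smul g⁻¹)

end Pattern

/-! ### An invariant measure on patterns -/

section PatternMeasure

variable {G : Type u} [Group G] [TopologicalSpace G] [IsTopologicalGroup G]
  [LocallyCompactSpace G] [SecondCountableTopology G] [T2Space G] {L K : Set G} {Γ : Subgroup G}

/-- The patterns that are classes of `P` modulo `Γ`. -/
def classes (D K : Set G) (Γ : Subgroup G) (P : Set G) : Set (Pattern D K) :=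
  {Q | ∃ x ∈ P, Q.carrier = classOf Γ P x}

omit [LocallyCompactSpace G] [SecondCountableTopology G] [T2Space G] in
theorem smul_mem_classes {D : Set G} {P : Set G} (g : G) {Q : Pattern D K}
    (hQ : Q ∈ classes D K Γ P) : g • Q ∈ classes D K Γ (g • P) := by
  obtain ⟨x, hx, hxQ⟩ := hQ
  exact ⟨g * x, smul_mem_smul_set hx, by rw [Pattern.carrier_smul, hxQ, classOf_smul]⟩

omit [LocallyCompactSpace G] [SecondCountableTopology G] [T2Space G] in
-- The set of classes is equivariant; this is the source of the invariance of the measure on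
-- patterns.
theorem encard_inter_classes_smul {D : Set G} {P : Set G} (g : G) (E : Set (Pattern D K)) :
    (E ∩ classes D K Γ (g • P)).encard =
      ((fun Q : Pattern D K => g • Q) ⁻¹' E ∩ classes D K Γ P).encard := by
  rw [← (MulAction.injective (β := Pattern D K) g).encard_image (_ ⁻¹' E ∩ _)]
  congr 1
  ext Q
  constructor
  · rintro ⟨hE, hQ⟩
    refine ⟨g⁻¹ • Q, ⟨by simpa using hE, ?_⟩, by simp⟩
    simpa using smul_mem_classes g⁻¹ hQ
  · rintro ⟨Q, ⟨hE, hQ⟩, rfl⟩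
    exact ⟨hE, smul_mem_classes g hQ⟩

variable (Γ) in
/-- The relatively dense class of the point of `P ∩ C`, as a condition on `P`. -/
def HasClassAt (L K C : Set G) (P : ClosedSubsets G) : Prop :=
  P ∈ hull L ∧ (P.toSet ∩ C).Nonempty ∧
    ∀ g : G, ∃ y ∈ P.toSet ∩ C, ∃ x ∈ P.toSet ∩ g • K, y⁻¹ * x ∈ Γ

variable (hL : IsApproxSubgroup L) (hLL : LocFin (L * L)) (hK : IsCompact K)

omit [SecondCountableTopology G] in
include hL hLL in
-- Closedness is the only issue: seen from one of its points `y`, the class is `P ∩ y(L² ∩ Γ)`, and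
-- `L² ∩ Γ` is locally finite, hence closed.
theorem exists_pattern_of_mem_hull {P : ClosedSubsets G} (hP : P ∈ hull L) {x : G}
    (hx : ∀ g : G, (classOf Γ P.toSet x ∩ g • K).Nonempty) :
    ∃ Q : Pattern (L * L ∩ Γ) K, Q.carrier = classOf Γ P.toSet x := by
  have key : ∀ y ∈ classOf Γ P.toSet x, ∀ z ∈ classOf Γ P.toSet x, y⁻¹ * z ∈ L * L ∩ Γ := by
    intro y hy z hz
    refine ⟨inv_mul_mem_of_mem_hull hL hLL.isClosed hP hy.1 hz.1, ?_⟩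
    have : y⁻¹ * z = (x⁻¹ * y)⁻¹ * (x⁻¹ * z) := by group
    rw [this]
    exact Γ.mul_mem (Γ.inv_mem hy.2) hz.2
  refine ⟨⟨classOf Γ P.toSet x, ?_, key, hx⟩, rfl⟩
  obtain ⟨y, hy, -⟩ := hx 1
  have : classOf Γ P.toSet x = P.toSet ∩ (fun z => y⁻¹ * z) ⁻¹' (L * L ∩ Γ) := by
    ext z
    refine ⟨fun hz => ⟨hz.1, key y hy z hz⟩, fun hz => ?_⟩
    rw [← classOf_eq_of_mem hy]
    exact ⟨hz.1, hz.2.2⟩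
  rw [this]
  exact P.isClosed.inter ((hLL.mono inter_subset_left).isClosed.preimage (by fun_prop))

omit [SecondCountableTopology G] in
include hL hLL in
-- `Γ` itself need not be open. Quotients of points of `P` lie in `L²`, where `Γ` agrees with the
-- complement of the closed set `L² \ Γ`; this brings class membership within reach of
-- `HitMeasurable.of_pair`.
theorem exists_isOpen_iff_mem_subgroup : ∃ W : Set G, IsOpen W ∧ ∀ P ∈ hull L,
    ∀ x ∈ P.toSet, ∀ y ∈ P.toSet, (x⁻¹ * y ∈ W ↔ x⁻¹ * y ∈ Γ) := by
  refine ⟨((L * L) \ Γ)ᶜ, (hLL.mono sdiff_subset).isClosed.isOpen_compl, fun P hP x hx y hy => ?_⟩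
  have := inv_mul_mem_of_mem_hull hL hLL.isClosed hP hx hy
  simp [this]

include hL hLL hK in
-- A class hits `g • K` exactly when `g` lies in the class times `K⁻¹`, a closed set. Hence a
-- countable dense set of `g` suffices. The smallness of `C` ensures that the point of `P ∩ C` is
-- the same for all `g`.
theorem measurableSet_hasClassAt {C : Set G} (hC : IsCompact C)
    (hCL : ∀ x ∈ C, ∀ y ∈ C, x⁻¹ * y ∈ L * L → x = y) :
    MeasurableSet {P | HasClassAt Γ L K C P} := by
  obtain ⟨W, hW, hWΓ⟩ := exists_isOpen_iff_mem_subgroup (Γ := Γ) hL hLL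
  obtain ⟨T, hT, hTd⟩ := TopologicalSpace.exists_countable_dense G
  have : {P | HasClassAt Γ L K C P} = hull L ∩ ({P | (P.toSet ∩ C).Nonempty} ∩
      ⋂ g ∈ T, {P | ∃ y ∈ P.toSet ∩ C, ∃ x ∈ P.toSet ∩ g • K, y⁻¹ * x ∈ W}) := by
    ext P
    simp only [HasClassAt, mem_ofPred_eq, mem_inter_iff, mem_iInter]
    refine and_congr_right fun hP => and_congr_right fun hPC => ⟨fun h g _ => ?_, fun h g => ?_⟩
    · obtain ⟨y, hy, x, hx, hyx⟩ := h g
      exact ⟨y, hy, x, hx, (hWΓ P hP _ hy.1 _ hx.1).2 hyx⟩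
    · obtain ⟨y, hy⟩ := hPC
      have hcl : IsClosed {z | z ∈ P.toSet ∧ y⁻¹ * z ∈ L * L ∩ Γ} := P.isClosed.inter
        ((hLL.mono inter_subset_left).isClosed.preimage (by fun_prop))
      have hcl2 := hcl.mul_right_of_isCompact hK.inv
      have hsub : T ⊆ {z | z ∈ P.toSet ∧ y⁻¹ * z ∈ L * L ∩ Γ} * K⁻¹ := by
        intro t ht
        obtain ⟨y', hy', x, hx, hyx⟩ := h t ht
        obtain rfl := hCL y hy.2 y' hy'.2 (inv_mul_mem_of_mem_hull hL hLL.isClosed hP hy.1 hy'.1)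
        obtain ⟨k, hk, rfl⟩ := hx.2
        refine ⟨t • k, ⟨hx.1, inv_mul_mem_of_mem_hull hL hLL.isClosed hP hy.1 hx.1,
          (hWΓ P hP _ hy.1 _ hx.1).1 hyx⟩, k⁻¹, by simpa using hk, by simp⟩
      have huniv := hcl2.closure_subset_iff.2 hsub
      rw [hTd.closure_eq] at huniv
      obtain ⟨x, hx, k, hk, hxk⟩ := huniv (mem_univ g)
      refine ⟨y, hy, x, ⟨hx.1, ?_⟩, hx.2.2⟩
      rw [mem_smul_set_iff_inv_smul_mem, ← hxk]
      simpa using hk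
  rw [this]
  refine isClosed_closure.measurableSet.inter ((ClosedSubsets.hitMeasurable.of_isCompact C hC).inter
    (MeasurableSet.biInter hT fun g _ => ?_))
  exact ClosedSubsets.hitMeasurable.of_pair hC.isSigmaCompact (hK.smul g).isSigmaCompact hW

include hL hLL hK in
/-- The classes of elements of the hull are counted by a finite sum of indicator functions
that depend measurably on the data. -/
theorem exists_measurable_enumeration [hne : Nonempty (Pattern (L * L ∩ Γ) K)] :
    ∃ (n : ℕ) (A : Fin n → Set (ClosedSubsets G))
      (q : Fin n → ClosedSubsets G → Pattern (L * L ∩ Γ) K),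
      (∀ i, MeasurableSet (A i)) ∧ (∀ i, Measurable (q i)) ∧
      ∀ P ∈ hull L, BijOn (fun i => q i P) {i | P ∈ A i} (classes (L * L ∩ Γ) K Γ P.toSet) := by
  classical
  obtain ⟨W, hW, hWΓ⟩ := exists_isOpen_iff_mem_subgroup (Γ := Γ) hL hLL
  obtain ⟨U, hU, hUL⟩ := hLL.exists_nhds_one
  obtain ⟨n, C, hC, hKC, hCU⟩ := exists_small_compact_cover hK hU
  have hCL : ∀ i, ∀ x ∈ C i, ∀ y ∈ C i, x⁻¹ * y ∈ L * L → x = y := fun i x hx y hy h =>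
    inv_mul_eq_one.1 (hUL _ h (hCU i x hx y hy))
  -- A relatively dense class hits `K`, so it is labelled by the first cell that it meets: `P ∈ A j`
  -- when the class through `C j` is relatively dense and no point of `P` in an earlier cell belongs
  -- to it.
  set A : Fin n → Set (ClosedSubsets G) := fun j => {P | HasClassAt Γ L K (C j) P} ∩
    ⋂ i : Fin n, ⋂ _ : i < j, {P | ∃ y ∈ P.toSet ∩ C i, ∃ x ∈ P.toSet ∩ C j, y⁻¹ * x ∈ W}ᶜ with hA
  have hAmeas : ∀ j, MeasurableSet (A j) := fun j =>
    (measurableSet_hasClassAt hL hLL hK (hC j) (hCL j)).inter <|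
      MeasurableSet.iInter fun i => MeasurableSet.iInter fun _ =>
        (ClosedSubsets.hitMeasurable.of_pair (hC i).isSigmaCompact (hC j).isSigmaCompact hW).compl
  -- Off `A j` the value is a constant pattern, which keeps `q j` measurable on the whole space.
  have hex : ∀ (j : Fin n) (P : ClosedSubsets G), ∃ Q : Pattern (L * L ∩ Γ) K,
      (P ∈ A j → ∀ y ∈ P.toSet ∩ C j, Q.carrier = classOf Γ P.toSet y) ∧
      (P ∉ A j → Q = Classical.choice hne) := by
    intro j P
    by_cases hP : P ∈ A j
    · obtain ⟨hPh, ⟨y, hy⟩, hPd⟩ := hP.1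
      obtain ⟨Q, hQ⟩ := exists_pattern_of_mem_hull (Γ := Γ) (K := K) hL hLL hPh (x := y)
        fun g => by
          obtain ⟨y', hy', x, hx, hyx⟩ := hPd g
          obtain rfl := hCL j y hy.2 y' hy'.2
            (inv_mul_mem_of_mem_hull hL hLL.isClosed hPh hy.1 hy'.1)
          exact ⟨x, ⟨hx.1, hyx⟩, hx.2⟩
      refine ⟨Q, fun _ y' hy' => ?_, fun h => absurd hP h⟩
      obtain rfl := hCL j y hy.2 y' hy'.2
        (inv_mul_mem_of_mem_hull hL hLL.isClosed hPh hy.1 hy'.1)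
      exact hQ
    · exact ⟨Classical.choice hne, fun h => absurd h hP, fun _ => rfl⟩
  choose q hq1 hq2 using hex
  refine ⟨n, A, q, hAmeas, fun j => ?_, fun P hP => ⟨?_, ?_, ?_⟩⟩
  · refine measurable_generateFrom ?_
    rintro _ ⟨V, hV, rfl⟩
    have : q j ⁻¹' {Q | (Q.carrier ∩ V).Nonempty} =
        (A j ∩ {P | ∃ y ∈ P.toSet ∩ C j, ∃ x ∈ P.toSet ∩ V, y⁻¹ * x ∈ W}) ∪
        ((A j)ᶜ ∩ {_P | ((Classical.choice hne).carrier ∩ V).Nonempty}) := by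
      ext P
      simp only [mem_preimage, mem_ofPred_eq, mem_union, mem_inter_iff, mem_compl_iff]
      by_cases hP : P ∈ A j
      · obtain ⟨hPh, ⟨y, hy⟩, -⟩ := hP.1
        simp only [hP, true_and, not_true_eq_false, false_and, or_false]
        rw [hq1 j P hP y hy]
        constructor
        · rintro ⟨x, hx, hxV⟩
          exact ⟨y, hy, x, ⟨hx.1, hxV⟩, (hWΓ P hPh _ hy.1 _ hx.1).2 hx.2⟩
        · rintro ⟨y', hy', x, hx, hyx⟩
          obtain rfl := hCL j y hy.2 y' hy'.2
            (inv_mul_mem_of_mem_hull hL hLL.isClosed hPh hy.1 hy'.1)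
          exact ⟨x, ⟨hx.1, (hWΓ P hPh _ hy.1 _ hx.1).1 hyx⟩, hx.2⟩
      · simp only [hP, false_and, not_false_eq_true, true_and, false_or]
        rw [hq2 j P hP]
    rw [this]
    refine ((hAmeas j).inter ?_).union ((hAmeas j).compl.inter (MeasurableSet.const _))
    exact ClosedSubsets.hitMeasurable.of_pair (hC j).isSigmaCompact
      (isSigmaCompact_of_isOpen hV) hW
  · intro j hj
    obtain ⟨y, hy⟩ := hj.1.2.1
    exact ⟨y, hy.1, hq1 j P hj y hy⟩
  · have aux : ∀ i j : Fin n, i < j → P ∈ A i → P ∈ A j → q i P ≠ q j P := by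
      intro i j hij hi hj h
      obtain ⟨y, hy⟩ := hi.1.2.1
      obtain ⟨x, hx⟩ := hj.1.2.1
      have h1 : x ∈ (q j P).carrier := by
        rw [hq1 j P hj x hx]
        exact mem_classOf_self hx.1
      rw [← h, hq1 i P hi y hy] at h1
      have h2 := hj.2
      simp only [mem_iInter] at h2
      exact h2 i hij ⟨y, hy, x, hx, (hWΓ P hP _ hy.1 _ hx.1).2 h1.2⟩
    intro i hi j hj hij
    rcases lt_trichotomy i j with h | h | h
    · exact absurd hij (aux i j h hi hj)
    · exact h
    · exact absurd hij.symm (aux j i h hj hi)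
  · rintro Q ⟨x, hx, hQ⟩
    have hex : ∃ j, (Q.carrier ∩ C j).Nonempty := by
      obtain ⟨y, hy, hyK⟩ := Q.hits 1
      rw [one_smul] at hyK
      obtain ⟨j, hj⟩ := mem_iUnion.1 (hKC hyK)
      exact ⟨j, y, hy, hj⟩
    obtain ⟨j, hj, hjmin⟩ := WellFounded.has_min (wellFounded_lt (α := Fin n))
      {j | (Q.carrier ∩ C j).Nonempty} hex
    obtain ⟨y, hyQ, hyC⟩ := hj
    have hy : y ∈ classOf Γ P.toSet x := hQ ▸ hyQ
    have hQy : Q.carrier = classOf Γ P.toSet y := by rw [hQ, classOf_eq_of_mem hy]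
    have hPj : P ∈ A j := by
      refine ⟨⟨hP, ⟨y, hy.1, hyC⟩, fun g => ?_⟩, ?_⟩
      · obtain ⟨z, hz, hzK⟩ := Q.hits g
        rw [hQy] at hz
        exact ⟨y, ⟨hy.1, hyC⟩, z, ⟨hz.1, hzK⟩, hz.2⟩
      · simp only [mem_iInter]
        rintro i hij ⟨a, ha, b, hb, hab⟩
        obtain rfl := hCL j y hyC b hb.2
          (inv_mul_mem_of_mem_hull hL hLL.isClosed hP hy.1 hb.1)
        refine hjmin i ⟨a, ?_, ha.2⟩ hij
        rw [hQy]
        refine ⟨ha.1, ?_⟩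
        have := Γ.inv_mem ((hWΓ P hP _ ha.1 _ hb.1).1 hab)
        simpa using this
    refine ⟨j, hPj, Pattern.ext ?_⟩
    rw [hq1 j P hPj y ⟨hy.1, hyC⟩, hQy]

include hL hLL hK in
/-- An invariant probability measure on the hull of `L` induces a finite invariant measure on
the relatively dense patterns with quotients in a subgroup. -/
theorem exists_invariant_measure_pattern
    (hcl : ∀ P ∈ hull L, ∃ x ∈ P.toSet, ∀ g : G, (classOf Γ P.toSet x ∩ g • K).Nonempty)
    {ν : Measure (ClosedSubsets G)} [IsProbabilityMeasure ν] (hν : ν (hull L)ᶜ = 0)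
    (hinv : ∀ g : G, MeasurePreserving (ClosedSubsets.translate g) ν ν) :
    ∃ m : Measure (Pattern (L * L ∩ Γ) K), IsFiniteMeasure m ∧ m univ ≠ 0 ∧
      ∀ g : G, MeasurePreserving (fun Q : Pattern (L * L ∩ Γ) K => g • Q) m m := by
  classical
  have hclasses : ∀ P ∈ hull L, (classes (L * L ∩ Γ) K Γ P.toSet).Nonempty := by
    intro P hP
    obtain ⟨x, hx, hxd⟩ := hcl P hP
    obtain ⟨Q, hQ⟩ := exists_pattern_of_mem_hull hL hLL hP hxd
    exact ⟨Q, x, hx, hQ⟩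
  have hae : ∀ᵐ P ∂ν, P ∈ hull L := hν
  have hne : Nonempty (Pattern (L * L ∩ Γ) K) := by
    obtain ⟨P, hP⟩ := hae.exists
    exact ⟨(hclasses P hP).some⟩
  obtain ⟨n, A, q, hA, hq, hbij⟩ := exists_measurable_enumeration (Γ := Γ) hL hLL hK
  -- `N E P` is the number of classes of `P` belonging to `E`. Being independent of the enumeration,
  -- it is equivariant although the maps `q j` are not asserted to be.
  let N : Set (Pattern (L * L ∩ Γ) K) → ClosedSubsets G → ℝ≥0∞ := fun E P =>
    ∑ j, (A j ∩ q j ⁻¹' E).indicator 1 P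
  have hNmeas : ∀ E, MeasurableSet E → Measurable (N E) := fun E hE =>
    Finset.measurable_sum _ fun j _ => measurable_one.indicator ((hA j).inter (hq j hE))
  have hN : ∀ E, ∀ P ∈ hull L, N E P =
      ((E ∩ classes (L * L ∩ Γ) K Γ P.toSet).encard : ℝ≥0∞) := by
    intro E P hP
    have h1 : E ∩ classes (L * L ∩ Γ) K Γ P.toSet =
        (fun j => q j P) '' ((Finset.univ.filter fun j => P ∈ A j ∧ q j P ∈ E : Finset (Fin n)) :
          Set (Fin n)) := by
      rw [← (hbij P hP).image_eq]
      ext Q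
      constructor
      · rintro ⟨hE, j, hj, rfl⟩
        exact ⟨j, by simpa using ⟨hj, hE⟩, rfl⟩
      · rintro ⟨j, hj, rfl⟩
        have hj' : P ∈ A j ∧ q j P ∈ E := by simpa using hj
        exact ⟨hj'.2, j, hj'.1, rfl⟩
    rw [h1, ((hbij P hP).injOn.mono _).encard_image, encard_coe_eq_coe_finsetCard]
    · simp only [N, indicator_apply, mem_inter_iff, mem_preimage, Pi.one_apply]
      rw [Finset.sum_boole]
      rfl
    · intro j hj
      have hj' : P ∈ A j ∧ q j P ∈ E := by simpa using hj
      exact hj'.1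
  let m : Measure (Pattern (L * L ∩ Γ) K) := ∑ j, (ν.restrict (A j)).map (q j)
  have hm : ∀ E, MeasurableSet E → m E = ∫⁻ P, N E P ∂ν := by
    intro E hE
    simp only [N, m, Measure.coe_finsetSum, Finset.sum_apply]
    rw [lintegral_finsetSum _ fun j _ => measurable_one.indicator ((hA j).inter (hq j hE))]
    refine Finset.sum_congr rfl fun j _ => ?_
    rw [Measure.map_apply (hq j) hE, Measure.restrict_apply (hq j hE),
      lintegral_indicator_one ((hA j).inter (hq j hE)), inter_comm]
  refine ⟨m, ⟨?_⟩, ?_, fun g => ⟨Pattern.measurable_smul g, ?_⟩⟩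
  · simp only [m, Measure.coe_finsetSum, Finset.sum_apply]
    exact ENNReal.sum_lt_top.2 fun j _ => measure_lt_top _ _
  -- Almost every `P` has at least one relatively dense class.
  · have h1 : (1 : ℝ≥0∞) ≤ m univ := by
      rw [hm _ MeasurableSet.univ]
      calc (1 : ℝ≥0∞) = ∫⁻ _, 1 ∂ν := by simp
        _ ≤ _ := by
          refine lintegral_mono_ae ?_
          filter_upwards [hae] with P hP
          rw [hN _ P hP, univ_inter]
          exact_mod_cast one_le_encard_iff_nonempty.2 (hclasses P hP)
    exact (lt_of_lt_of_le one_pos h1).ne'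
  · ext E hE
    rw [Measure.map_apply (Pattern.measurable_smul g) hE,
      hm _ (Pattern.measurable_smul g hE), hm E hE, ← (hinv g).lintegral_comp (hNmeas E hE)]
    refine lintegral_congr_ae ?_
    filter_upwards [hae] with P hP
    rw [hN _ P hP, hN _ _ (translate_mem_hull hP g)]
    congr 1
    exact (encard_inter_classes_smul g E).symm

end PatternMeasure

/-! ### The return cocycle of a measured family of patterns -/

/-- A measurable cocycle on a measured `G`-space, with the continuity, finiteness and properness
properties that are needed to induce affine actions from a discrete group `Γ` to `G`. -/
structure IsInducingCocycle {G Γ Y : Type*} [Group G] [TopologicalSpace G] [Group Γ]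
    [MeasurableSpace Y] [MulAction G Y] (m : Measure Y) (D : Set Γ) (c : G → Y → Γ) : Prop where
  map_mul : ∀ g h y, c (g * h) y = c g y * c h (g⁻¹ • y)
  mem : ∀ g y, c g y ∈ D
  measurableSet_eq : ∀ g γ, MeasurableSet {y | c g y = γ}
  tendsto_ne : ∀ g₀, Filter.Tendsto (fun g => m {y | c g y ≠ c g₀ y}) (𝓝 g₀) (𝓝 0)
  tendsto_symmDiff : ∀ A, MeasurableSet A → ∀ g₀ : G, Filter.Tendsto
    (fun g : G => m (symmDiff ((fun y => g⁻¹ • y) ⁻¹' A) ((fun y => g₀⁻¹ • y) ⁻¹' A)))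
    (𝓝 g₀) (𝓝 0)
  exists_finite : ∀ g₀, ∃ T : Set Γ, T.Finite ∧ ∀ᶠ g in 𝓝 g₀, ∀ y, c g y ∈ T
  isCompact_closure : ∀ T : Set Γ, T.Finite → IsCompact (closure {g | ∃ y, c g y ∈ T})

namespace Pattern

variable {G : Type u} [Group G] [TopologicalSpace G] [IsTopologicalGroup G] {D K : Set G}
  {m : Measure (Pattern D K)} [IsFiniteMeasure m]

section
variable (hm : ∀ g : G, MeasurePreserving (fun Q : Pattern D K => g • Q) m m)
include hm

omit [IsFiniteMeasure m] in
theorem measure_preimage_smul (g : G) {A : Set (Pattern D K)} (hA : MeasurableSet A) :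
    m ((fun Q => g • Q) ⁻¹' A) = m A :=
  (hm g).measure_preimage hA.nullMeasurableSet

variable [FirstCountableTopology G]

/-- The action on a measured space of patterns is continuous in measure. -/
theorem tendsto_measure_symmDiff_smul {A : Set (Pattern D K)} (hA : MeasurableSet A) :
    Filter.Tendsto (fun k : G => m (symmDiff ((fun Q => k⁻¹ • Q) ⁻¹' A) A)) (𝓝 1) (𝓝 0) := by
  induction A, hA using MeasurableSpace.generateFrom_induction with
  | hC A hA hAm =>
    obtain ⟨V, hV, rfl⟩ := hA
    set A := {Q : Pattern D K | (Q.carrier ∩ V).Nonempty}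
    -- A point of `Q` in the open set `V` stays in `V` under small translations. The other half of
    -- the symmetric difference follows by invariance, with `k` replaced by `k⁻¹`.
    have h1 : Filter.Tendsto (fun k : G => m (A \ (fun Q => k⁻¹ • Q) ⁻¹' A)) (𝓝 1) (𝓝 0) := by
      rw [← measure_empty (μ := m)]
      refine tendsto_measure_of_tendsto_indicator_of_isFiniteMeasure _ m
        (fun k => hAm.diff (measurable_smul _ hAm)) fun Q => ?_
      by_cases hQ : Q ∈ A
      · obtain ⟨x, hx, hxV⟩ := hQ
        have h2 : ∀ᶠ k : G in 𝓝 1, k⁻¹ * x ∈ V := by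
          have : Continuous fun k : G => k⁻¹ * x := by fun_prop
          exact this.tendsto 1 (hV.mem_nhds (by simpa using hxV))
        filter_upwards [h2] with k hk
        simp only [mem_sdiff, mem_empty_iff_false, iff_false, not_and, not_not]
        exact fun _ => ⟨k⁻¹ * x, smul_mem_smul_set hx, hk⟩
      · exact Filter.Eventually.of_forall fun k => by simp [hQ]
    have h2 : Filter.Tendsto (fun k : G => m ((fun Q => k⁻¹ • Q) ⁻¹' A \ A)) (𝓝 1) (𝓝 0) := by
      have h3 : Filter.Tendsto (fun k : G => k⁻¹) (𝓝 1) (𝓝 1) := by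
        simpa using (continuous_inv (G := G)).tendsto 1
      refine (h1.comp h3).congr fun k => ?_
      simp only [Function.comp, inv_inv]
      rw [← measure_preimage_smul hm k⁻¹ (hAm.diff (measurable_smul k hAm))]
      congr 1
      ext Q
      simp
    refine tendsto_of_tendsto_of_tendsto_of_le_of_le tendsto_const_nhds
      (by simpa using h2.add h1) (fun _ => zero_le) fun k => ?_
    exact measure_union_le _ _
  | empty => simp
  | compl A hA ih => simpa [compl_symmDiff_compl] using ih
  | iUnion A hA ih =>
    rw [ENNReal.tendsto_nhds_zero]
    intro ε hε
    -- Tails of the union: invariance bounds their translates by the same small measure for all `k`,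
    -- leaving a finite sum.
    set R : ℕ → Set (Pattern D K) := fun N => (⋃ i, A i) \ ⋃ i ∈ Finset.range N, A i
    have hR : ∀ N, MeasurableSet (R N) := fun N =>
      (MeasurableSet.iUnion hA).diff (Finset.measurableSet_biUnion _ fun i _ => hA i)
    have hRlim : Filter.Tendsto (fun N => m (R N)) Filter.atTop (𝓝 0) := by
      rw [← measure_empty (μ := m)]
      refine tendsto_measure_of_tendsto_indicator_of_isFiniteMeasure _ m hR fun Q => ?_
      by_cases hQ : Q ∈ ⋃ i, A i
      · obtain ⟨i, hi⟩ := mem_iUnion.1 hQ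
        filter_upwards [Filter.eventually_gt_atTop i] with N hN
        simp only [R, mem_sdiff, mem_empty_iff_false, iff_false, not_and, not_not]
        exact fun _ => mem_iUnion₂.2 ⟨i, Finset.mem_range.2 hN, hi⟩
      · exact Filter.Eventually.of_forall fun k => by
          simp only [R, mem_sdiff, hQ, false_and, mem_empty_iff_false]
    have hε3 : 0 < ε / 3 := ENNReal.div_pos hε.ne' (by simp)
    obtain ⟨N, hN⟩ := ((ENNReal.tendsto_nhds_zero.1 hRlim) _ hε3).exists
    have hsum : Filter.Tendsto (fun k : G => ∑ i ∈ Finset.range N,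
        m (symmDiff ((fun Q => k⁻¹ • Q) ⁻¹' A i) (A i))) (𝓝 1) (𝓝 0) := by
      simpa using tendsto_finsetSum (Finset.range N) fun i _ => ih i
    filter_upwards [(ENNReal.tendsto_nhds_zero.1 hsum) _ hε3] with k hk
    have hsub : symmDiff ((fun Q => k⁻¹ • Q) ⁻¹' ⋃ i, A i) (⋃ i, A i) ⊆
        (⋃ i ∈ Finset.range N, symmDiff ((fun Q => k⁻¹ • Q) ⁻¹' A i) (A i)) ∪
          (((fun Q => k⁻¹ • Q) ⁻¹' R N) ∪ R N) := by
      intro Q hQ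
      by_cases h1 : ∃ i ∈ Finset.range N, Q ∈ symmDiff ((fun Q => k⁻¹ • Q) ⁻¹' A i) (A i)
      · exact Or.inl (by simpa only [mem_iUnion, exists_prop] using h1)
      right
      push Not at h1
      simp only [mem_symmDiff, mem_preimage] at h1 hQ
      have h2 : ∀ i ∈ Finset.range N, (k⁻¹ • Q ∈ A i ↔ Q ∈ A i) := fun i hi => by
        have := h1 i hi
        tauto
      have h3 : k⁻¹ • Q ∈ ⋃ i ∈ Finset.range N, A i ↔ Q ∈ ⋃ i ∈ Finset.range N, A i := by
        simp only [mem_iUnion, exists_prop]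
        exact exists_congr fun i => and_congr_right (h2 i)
      have h4 : (⋃ i ∈ Finset.range N, A i) ⊆ ⋃ i, A i :=
        iUnion₂_subset fun i _ => subset_iUnion A i
      simp only [R, mem_union, mem_preimage, mem_sdiff]
      have h5 := @h4 Q
      have h6 := @h4 (k⁻¹ • Q)
      tauto
    calc m _ ≤ _ := measure_mono hsub
      _ ≤ (∑ i ∈ Finset.range N, m (symmDiff ((fun Q => k⁻¹ • Q) ⁻¹' A i) (A i))) +
          (m ((fun Q => k⁻¹ • Q) ⁻¹' R N) + m (R N)) :=
        (measure_union_le _ _).trans (add_le_add (measure_biUnion_finset_le _ _)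
          (measure_union_le _ _))
      _ ≤ ε / 3 + (ε / 3 + ε / 3) := by
        rw [measure_preimage_smul hm _ (hR N)]
        gcongr
      _ = ε := by rw [← add_assoc, ENNReal.add_thirds]

variable [LocallyCompactSpace G] [SecondCountableTopology G] [T2Space G]

omit hm in
-- For a fixed `Q` only finitely many points near `C` lie outside it, and each stays outside under
-- small translations; dominated convergence then applies.
theorem tendsto_measure_hit_smul_diff (hD : LocFin D) {C : Set G} (hC : IsCompact C) :
    Filter.Tendsto (fun k : G => m {Q | (Q.carrier ∩ (k • C \ C)).Nonempty}) (𝓝 1) (𝓝 0) := by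
  rw [← measure_empty (μ := m)]
  refine tendsto_measure_of_tendsto_indicator_of_isFiniteMeasure _ m (fun k => ?_) fun Q => ?_
  · exact hitMeasurable.of_isSigmaCompact (isSigmaCompact_inter (hC.smul k).isSigmaCompact
      (isSigmaCompact_of_isOpen hC.isClosed.isOpen_compl))
  · obtain ⟨N, hN, hN1⟩ := exists_compact_mem_nhds (1 : G)
    have h1 := Q.locFin hD (N * C) (hN.mul hC)
    have h2 : ∀ᶠ k : G in 𝓝 1, ∀ x ∈ (Q.carrier ∩ (N * C)) \ C, k⁻¹ * x ∈ Cᶜ := by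
      rw [Filter.eventually_all_finite (h1.subset sdiff_subset)]
      intro x hx
      have : Continuous fun k : G => k⁻¹ * x := by fun_prop
      exact this.tendsto 1 (hC.isClosed.isOpen_compl.mem_nhds (by simpa using hx.2))
    filter_upwards [h2, hN1] with k hk hkN
    simp only [mem_empty_iff_false, iff_false]
    rintro ⟨x, hx, hxk, hxC⟩
    refine hk x ⟨⟨hx, ?_⟩, hxC⟩ (by simpa [mem_smul_set_iff_inv_smul_mem] using hxk)
    obtain ⟨z, hz, rfl⟩ := hxk
    exact mul_mem_mul hkN hz

theorem tendsto_measure_hit_diff_smul (hD : LocFin D) {C : Set G} (hC : IsCompact C) :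
    Filter.Tendsto (fun k : G => m {Q | (Q.carrier ∩ (C \ k • C)).Nonempty}) (𝓝 1) (𝓝 0) := by
  have h3 : Filter.Tendsto (fun k : G => k⁻¹) (𝓝 1) (𝓝 1) := by
    simpa using (continuous_inv (G := G)).tendsto 1
  refine ((tendsto_measure_hit_smul_diff (m := m) hD hC).comp h3).congr fun k => ?_
  have hmeas : MeasurableSet {Q : Pattern D K | (Q.carrier ∩ (k⁻¹ • C \ C)).Nonempty} :=
    hitMeasurable.of_isSigmaCompact (isSigmaCompact_inter (hC.smul _).isSigmaCompact
      (isSigmaCompact_of_isOpen hC.isClosed.isOpen_compl))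
  simp only [Function.comp]
  rw [← measure_preimage_smul hm k⁻¹ hmeas]
  congr 1
  ext Q
  simp only [mem_preimage, mem_ofPred_eq, carrier_smul]
  rw [smul_inter_nonempty_iff, smul_set_sdiff, smul_smul, inv_inv, mul_inv_cancel, one_smul]

end

variable [LocallyCompactSpace G] [SecondCountableTopology G] [T2Space G]

/-- A measurable choice of a point in every pattern that is almost equivariant under small
translations. -/
theorem exists_section (hD : LocFin D) (hK : IsCompact K) :
    ∃ (s : Pattern D K → G) (C : Set G), IsCompact C ∧ (∀ Q, s Q ∈ Q.carrier) ∧ (∀ Q, s Q ∈ C) ∧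
      (∀ V, IsOpen V → MeasurableSet (s ⁻¹' V)) ∧
      ∀ (m : Measure (Pattern D K)) [IsFiniteMeasure m],
        (∀ g : G, MeasurePreserving (fun Q : Pattern D K => g • Q) m m) →
        Filter.Tendsto (fun k : G => m {Q | k * s (k⁻¹ • Q) ≠ s Q}) (𝓝 1) (𝓝 0) := by
  classical
  obtain ⟨U, hU, hUD⟩ := hD.exists_nhds_one
  obtain ⟨n, C, hC, hKC, hCU⟩ := exists_small_compact_cover hK hU
  have huniq : ∀ (Q : Pattern D K) (i : Fin n), ∀ x ∈ Q.carrier, x ∈ C i → ∀ y ∈ Q.carrier,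
      y ∈ C i → x = y := fun Q i x hx hxC y hy hyC =>
    inv_mul_eq_one.1 (hUD _ (Q.inv_mul_mem x hx y hy) (hCU i x hxC y hyC))
  -- The section `s Q` is the point of `Q` in the first cell that `Q` meets; small cells make it
  -- unique.
  have hex : ∀ Q : Pattern D K, ∃ j x, x ∈ Q.carrier ∩ C j ∧
      ∀ i < j, ¬ (Q.carrier ∩ C i).Nonempty := by
    intro Q
    have hex : ∃ j, (Q.carrier ∩ C j).Nonempty := by
      obtain ⟨y, hy, hyK⟩ := Q.hits 1
      rw [one_smul] at hyK
      obtain ⟨j, hj⟩ := mem_iUnion.1 (hKC hyK)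
      exact ⟨j, y, hy, hj⟩
    obtain ⟨j, ⟨x, hx⟩, hjmin⟩ := WellFounded.has_min (wellFounded_lt (α := Fin n))
      {j | (Q.carrier ∩ C j).Nonempty} hex
    exact ⟨j, x, hx, fun i hij hi => hjmin i hi hij⟩
  choose j s hs hjmin using hex
  refine ⟨s, ⋃ i, C i, isCompact_iUnion hC, fun Q => (hs Q).1,
    fun Q => mem_iUnion.2 ⟨_, (hs Q).2⟩, fun V hV => ?_, fun m _ hm => ?_⟩
  · have : s ⁻¹' V = ⋃ i, ({Q | (Q.carrier ∩ (C i ∩ V)).Nonempty} ∩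
        ⋂ l, ⋂ _ : l < i, {Q | (Q.carrier ∩ C l).Nonempty}ᶜ) := by
      ext Q
      simp only [mem_preimage, mem_iUnion, mem_inter_iff, mem_iInter, mem_compl_iff, mem_ofPred_eq]
      constructor
      · exact fun h => ⟨j Q, ⟨s Q, (hs Q).1, (hs Q).2, h⟩, hjmin Q⟩
      · rintro ⟨i, ⟨x, hx, hxC, hxV⟩, hi⟩
        have hij : i = j Q := by
          rcases lt_trichotomy i (j Q) with h | h | h
          · exact absurd ⟨x, hx, hxC⟩ (hjmin Q i h)
          · exact h
          · exact absurd ⟨s Q, hs Q⟩ (hi _ h)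
        subst hij
        rwa [huniq Q _ _ (hs Q).1 (hs Q).2 x hx hxC]
    rw [this]
    refine MeasurableSet.iUnion fun i => MeasurableSet.inter ?_ <| MeasurableSet.iInter fun l =>
      MeasurableSet.iInter fun _ => (hitMeasurable.of_isCompact _ (hC l)).compl
    exact hitMeasurable.of_isSigmaCompact
      (isSigmaCompact_inter (hC i).isSigmaCompact (isSigmaCompact_of_isOpen hV))
  · have hlim : Filter.Tendsto (fun k : G => ∑ i : Fin n,
        (m {Q | (Q.carrier ∩ (k • C i \ C i)).Nonempty} +
          m {Q | (Q.carrier ∩ (C i \ k • C i)).Nonempty})) (𝓝 1) (𝓝 0) := by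
      simpa using tendsto_finsetSum Finset.univ fun i (_ : i ∈ Finset.univ) =>
        (tendsto_measure_hit_smul_diff hD (hC i)).add
          (tendsto_measure_hit_diff_smul hm hD (hC i))
    refine tendsto_of_tendsto_of_tendsto_of_le_of_le tendsto_const_nhds hlim
      (fun _ => zero_le) fun k => ?_
    -- If no point of `Q` distinguishes a cell from its translate by `k`, then `Q` and `k⁻¹ • Q`
    -- meet the same cells and their chosen points correspond.
    have hsub : {Q | k * s (k⁻¹ • Q) ≠ s Q} ⊆ ⋃ i : Fin n,
        ({Q : Pattern D K | (Q.carrier ∩ (k • C i \ C i)).Nonempty} ∪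
          {Q | (Q.carrier ∩ (C i \ k • C i)).Nonempty}) := by
      intro Q hQ
      by_contra hcon
      simp only [mem_iUnion, mem_union, mem_ofPred_eq, not_exists, not_or] at hcon
      have h1 : ∀ i, ∀ x ∈ Q.carrier, (x ∈ k • C i ↔ x ∈ C i) := fun i x hx =>
        ⟨fun h => by_contra fun h' => (hcon i).1 ⟨x, hx, h, h'⟩,
          fun h => by_contra fun h' => (hcon i).2 ⟨x, hx, h, h'⟩⟩
      have h2 : ∀ i, ((k⁻¹ • Q).carrier ∩ C i).Nonempty ↔ (Q.carrier ∩ C i).Nonempty := by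
        intro i
        rw [carrier_smul, smul_inter_nonempty_iff, inv_inv]
        exact exists_congr fun x => and_congr_right fun hx => h1 i x hx
      have hkQ : k * s (k⁻¹ • Q) ∈ Q.carrier := by
        have := (hs (k⁻¹ • Q)).1
        rwa [carrier_smul, mem_smul_set_iff_inv_smul_mem, inv_inv] at this
      have hkC : k * s (k⁻¹ • Q) ∈ C (j (k⁻¹ • Q)) :=
        (h1 _ _ hkQ).1 (smul_mem_smul_set (hs (k⁻¹ • Q)).2)
      have hj : j (k⁻¹ • Q) = j Q := by
        rcases lt_trichotomy (j (k⁻¹ • Q)) (j Q) with h | h | h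
        · exact absurd ⟨_, hkQ, hkC⟩ (hjmin Q _ h)
        · exact h
        · exact absurd ((h2 _).2 ⟨s Q, hs Q⟩) (hjmin _ _ h)
      rw [hj] at hkC
      exact hQ (huniq Q _ _ hkQ hkC _ (hs Q).1 (hs Q).2)
    exact (measure_mono hsub).trans ((measure_iUnion_fintype_le _ _).trans
      (Finset.sum_le_sum fun i _ => measure_union_le _ _))

/-- A finite invariant measure on patterns with quotients in a subgroup `Γ` gives rise to a
cocycle with values in `Γ`. -/
theorem exists_isInducingCocycle (hD : LocFin D) (hK : IsCompact K) {Γ : Subgroup G}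
    (hDΓ : D ⊆ Γ) (hm : ∀ g : G, MeasurePreserving (fun Q : Pattern D K => g • Q) m m) :
    ∃ c : G → Pattern D K → Γ, IsInducingCocycle m {γ : Γ | (γ : G) ∈ D} c := by
  obtain ⟨s, C, hC, hs, hsC, hsm, hs1⟩ := exists_section (D := D) hD hK
  have hgs : ∀ (g : G) (Q : Pattern D K), g * s (g⁻¹ • Q) ∈ Q.carrier := fun g Q => by
    have := hs (g⁻¹ • Q)
    rwa [carrier_smul, mem_smul_set_iff_inv_smul_mem, inv_inv] at this
  have hmem : ∀ (g : G) (Q : Pattern D K), (s Q)⁻¹ * (g * s (g⁻¹ • Q)) ∈ D := fun g Q =>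
    Q.inv_mul_mem _ (hs Q) _ (hgs g Q)
  -- Both `s Q` and `g * s (g⁻¹ • Q)` are points of `Q`, so their quotient lies in `D`.
  refine ⟨fun g Q => ⟨(s Q)⁻¹ * (g * s (g⁻¹ • Q)), hDΓ (hmem g Q)⟩, ?_, ?_, ?_, ?_, ?_, ?_, ?_⟩
  · intro g h Q
    ext
    simp [mul_assoc, mul_smul]
  · exact hmem
  · intro g γ
    borelize G
    have h1 : Measurable s := measurable_of_isOpen hsm
    have h2 : Measurable fun Q : Pattern D K => (s Q)⁻¹ * (g * s (g⁻¹ • Q)) :=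
      h1.inv.mul ((h1.comp (measurable_smul g⁻¹)).const_mul g)
    have h3 := h2 (measurableSet_singleton (γ : G))
    convert h3 using 1
    ext Q
    simp [Subtype.ext_iff]
  · intro g₀
    have h1 : Filter.Tendsto (fun g : G => g₀⁻¹ * g) (𝓝 g₀) (𝓝 1) := by
      have : Continuous fun g : G => g₀⁻¹ * g := by fun_prop
      simpa using this.tendsto g₀
    -- Translating by `g₀` turns `c g ≠ c g₀` into the failure of equivariance of `s` under `g₀⁻¹ *
    -- g`.
    refine ((hs1 m hm).comp h1).congr fun g => ?_
    have hmeas : MeasurableSet {Q : Pattern D K | g₀⁻¹ * g * s ((g₀⁻¹ * g)⁻¹ • Q) ≠ s Q} := by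
      borelize G
      have h1 : Measurable s := measurable_of_isOpen hsm
      exact (measurableSet_eq_fun ((h1.comp (measurable_smul _)).const_mul _) h1).compl
    simp only [Function.comp]
    rw [← measure_preimage_smul hm g₀⁻¹ hmeas]
    congr 1
    ext Q
    simp only [mem_preimage, mem_ofPred_eq, ne_eq, Subtype.mk.injEq, mul_right_inj, smul_smul]
    rw [← mul_right_inj g₀]
    simp [mul_assoc]
  · intro A hA g₀
    have h1 : Filter.Tendsto (fun g : G => g₀⁻¹ * g) (𝓝 g₀) (𝓝 1) := by
      have : Continuous fun g : G => g₀⁻¹ * g := by fun_prop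
      simpa using this.tendsto g₀
    refine ((tendsto_measure_symmDiff_smul hm hA).comp h1).congr fun g => ?_
    simp only [Function.comp]
    rw [← measure_preimage_smul hm g₀⁻¹ ((measurable_smul _ hA).symmDiff hA)]
    congr 1
    ext Q
    simp [mem_symmDiff, smul_smul]
  · intro g₀
    obtain ⟨N, hN, hNg⟩ := exists_compact_mem_nhds g₀
    refine ⟨{γ : Γ | (γ : G) ∈ D ∩ (C⁻¹ * (N * C))}, (hD _ (hC.inv.mul (hN.mul hC))).preimage
      Subtype.val_injective.injOn, ?_⟩
    filter_upwards [hNg] with g hg Q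
    exact ⟨hmem g Q, mul_mem_mul (by simpa using hsC Q) (mul_mem_mul hg (hsC _))⟩
  · intro T hT
    have hT' : IsCompact (Subtype.val '' T : Set G) := (hT.image _).isCompact
    -- Solve the definition of `c` for `g`: `g = s Q * c g Q * (s (g⁻¹ • Q))⁻¹`.
    refine ((hC.mul hT').mul hC.inv).closure_of_subset ?_
    rintro g ⟨Q, hQ⟩
    refine ⟨_, mul_mem_mul (hsC Q) (mem_image_of_mem _ hQ), (s (g⁻¹ • Q))⁻¹,
      by simpa using hsC (g⁻¹ • Q), ?_⟩
    simp

end Pattern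

/-! ### Induced affine actions -/

/-- A map with measurable fibres and finite range. -/
structure IsFiniteMeasurable {Y Γ : Type*} [MeasurableSpace Y] (κ : Y → Γ) : Prop where
  measurableSet_eq : ∀ γ, MeasurableSet {y | κ y = γ}
  exists_finite : ∃ T : Set Γ, T.Finite ∧ ∀ y, κ y ∈ T

section Twist

variable {Y Γ : Type*} [MeasurableSpace Y] {m : Measure Y}
  {E : Type*} [NormedAddCommGroup E] {p : ℝ≥0∞} {κ : Y → Γ}

/-- The fibres of `κ` form a finite measurable partition, so no regularity of `F` in the variable
`γ` is required. -/
theorem IsFiniteMeasurable.aestronglyMeasurable (hκ : IsFiniteMeasurable κ) {F : Γ → Y → E}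
    (hF : ∀ γ, AEStronglyMeasurable (F γ) m) : AEStronglyMeasurable (fun y => F (κ y) y) m := by
  obtain ⟨T, hT, hκT⟩ := hκ.exists_finite
  have : Countable T := hT.countable.to_subtype
  have huniv : (⋃ γ : T, {y | κ y = γ}) = univ :=
    eq_univ_of_forall fun y => mem_iUnion.2 ⟨⟨κ y, hκT y⟩, rfl⟩
  rw [← Measure.restrict_univ (μ := m), ← huniv, aestronglyMeasurable_iUnion_iff]
  intro γ
  refine (hF γ).restrict.congr ?_
  filter_upwards [ae_restrict_mem (hκ.measurableSet_eq γ)] with y hy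
  rw [show κ y = γ from hy]

theorem IsFiniteMeasurable.comp_memLp [IsFiniteMeasure m] (hκ : IsFiniteMeasurable κ)
    (b : Γ → E) : MemLp (fun y => b (κ y)) p m := by
  obtain ⟨T, hT, hκT⟩ := hκ.exists_finite
  obtain ⟨C, hC⟩ := (hT.image fun γ => ‖b γ‖).bddAbove
  exact MemLp.of_bound
    (hκ.aestronglyMeasurable (F := fun γ _ => b γ) fun γ => aestronglyMeasurable_const) C
    (Filter.Eventually.of_forall fun y => hC (mem_image_of_mem _ (hκT y)))

variable [NormedSpace ℝ E]

theorem IsFiniteMeasurable.twist_memLp (hκ : IsFiniteMeasurable κ) (π : Γ → E ≃ₗᵢ[ℝ] E)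
    {f : Y → E} (hf : MemLp f p m) : MemLp (fun y => π (κ y) (f y)) p m :=
  hf.congr_norm
    (hκ.aestronglyMeasurable (F := fun γ y => π γ (f y))
      fun γ => (π γ).continuous.comp_aestronglyMeasurable hf.1)
    (Filter.Eventually.of_forall fun y => by simp)

variable [Fact (1 ≤ p)]

/-- Pointwise application of a family of isometries to an `L^p`-function. -/
noncomputable def twist (m : Measure Y) (p : ℝ≥0∞) [Fact (1 ≤ p)] (hκ : IsFiniteMeasurable κ)
    (π : Γ → E ≃ₗᵢ[ℝ] E) : Lp E p m →ₗᵢ[ℝ] Lp E p m where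
  toFun f := (hκ.twist_memLp π (Lp.memLp f)).toLp _
  map_add' f g := by
    refine Lp.ext ?_
    filter_upwards [(hκ.twist_memLp π (Lp.memLp (f + g))).coeFn_toLp,
      (hκ.twist_memLp π (Lp.memLp f)).coeFn_toLp, (hκ.twist_memLp π (Lp.memLp g)).coeFn_toLp,
      Lp.coeFn_add f g, Lp.coeFn_add ((hκ.twist_memLp π (Lp.memLp f)).toLp _)
        ((hκ.twist_memLp π (Lp.memLp g)).toLp _)] with y h1 h2 h3 h4 h5
    rw [h1, h5, Pi.add_apply, h2, h3, h4, Pi.add_apply, map_add]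
  map_smul' a f := by
    refine Lp.ext ?_
    filter_upwards [(hκ.twist_memLp π (Lp.memLp (a • f))).coeFn_toLp,
      (hκ.twist_memLp π (Lp.memLp f)).coeFn_toLp,
      Lp.coeFn_smul a f, Lp.coeFn_smul a ((hκ.twist_memLp π (Lp.memLp f)).toLp _)]
      with y h1 h2 h4 h5
    rw [h1, RingHom.id_apply, h5, Pi.smul_apply, h2, h4, Pi.smul_apply, map_smul]
  norm_map' f := by
    change ‖(hκ.twist_memLp π (Lp.memLp f)).toLp _‖ = _
    rw [Lp.norm_toLp, Lp.norm_def]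
    congr 1
    exact eLpNorm_congr_norm_ae (Filter.Eventually.of_forall fun y => by simp)

theorem coeFn_twist (hκ : IsFiniteMeasurable κ) (π : Γ → E ≃ₗᵢ[ℝ] E) (f : Lp E p m) :
    twist m p hκ π f =ᵐ[m] fun y => π (κ y) (f y) :=
  (hκ.twist_memLp π (Lp.memLp f)).coeFn_toLp

theorem twist_surjective (hκ : IsFiniteMeasurable κ) (π : Γ → E ≃ₗᵢ[ℝ] E) :
    Function.Surjective (twist m p hκ π) := by
  intro f
  refine ⟨twist m p hκ (fun γ => (π γ).symm) f, Lp.ext ?_⟩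
  filter_upwards [coeFn_twist hκ π (twist m p hκ (fun γ => (π γ).symm) f),
    coeFn_twist hκ (fun γ => (π γ).symm) f] with y h1 h2
  rw [h1, h2, LinearIsometryEquiv.apply_symm_apply]

end Twist

theorem compMeasurePreserving_smul_surjective {G Y E : Type*} [Group G] [MeasurableSpace Y]
    [MulAction G Y] {m : Measure Y} (hm : ∀ g : G, MeasurePreserving (fun y : Y => g • y) m m)
    [NormedAddCommGroup E] {p : ℝ≥0∞} (g : G) :
    Function.Surjective (Lp.compMeasurePreserving (E := E) (p := p) _ (hm g)) := by
  intro f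
  refine ⟨Lp.compMeasurePreserving _ (hm g⁻¹) f, Lp.ext ?_⟩
  filter_upwards [Lp.coeFn_compMeasurePreserving (Lp.compMeasurePreserving _ (hm g⁻¹) f) (hm g),
    (hm g).quasiMeasurePreserving.ae (Lp.coeFn_compMeasurePreserving f (hm g⁻¹))] with y h1 h2
  rw [h1, Function.comp, h2, Function.comp, inv_smul_smul]

/-- Convergence in `L^p` of functions that agree up to a bounded error outside of small sets. -/
theorem tendsto_Lp_of_norm_le_indicator {ι Y E : Type*} [MeasurableSpace Y] {m : Measure Y}
    [NormedAddCommGroup E] {p : ℝ≥0∞} [Fact (1 ≤ p)] (hp : p ≠ ∞) {l : Filter ι}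
    {F : ι → Lp E p m} {f : Lp E p m} {B : ι → Set Y} {C : ℝ}
    (hF : ∀ᶠ i in l, ∀ᵐ y ∂m, ‖(F i - f) y‖ ≤ ‖(B i).indicator (fun _ => C) y‖)
    (hB : Filter.Tendsto (fun i => m (B i)) l (𝓝 0)) : Filter.Tendsto F l (𝓝 f) := by
  have hp0 : 0 < p.toReal :=
    ENNReal.toReal_pos (zero_lt_one.trans_le (Fact.out : 1 ≤ p)).ne' hp
  rw [tendsto_iff_edist_tendsto_0]
  have h1 : Filter.Tendsto (fun i => ‖C‖ₑ * m (B i) ^ (1 / p.toReal)) l (𝓝 0) := by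
    have h2 := (ENNReal.continuous_rpow_const (y := 1 / p.toReal)).tendsto 0 |>.comp hB
    rw [ENNReal.zero_rpow_of_pos (by positivity)] at h2
    simpa using ENNReal.Tendsto.const_mul h2 (Or.inr (by simp : ‖C‖ₑ ≠ ∞))
  refine tendsto_of_tendsto_of_tendsto_of_le_of_le' tendsto_const_nhds h1
    (Filter.Eventually.of_forall fun _ => zero_le) ?_
  filter_upwards [hF] with i hi
  rw [Lp.edist_def, ← eLpNorm_congr_ae (Lp.coeFn_sub (F i) f)]
  exact (eLpNorm_mono_ae hi).trans (eLpNorm_indicator_const_le _ _)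

namespace IsInducingCocycle

variable {G Γ Y : Type*} [Group G] [TopologicalSpace G] [Group Γ]
    [MeasurableSpace Y] [MulAction G Y] {m : Measure Y} {D : Set Γ} {c : G → Y → Γ}
    {E : Type*} [NormedAddCommGroup E] {p : ℝ≥0∞}

theorem isFiniteMeasurable (hc : IsInducingCocycle m D c) (g : G) : IsFiniteMeasurable (c g) := by
  obtain ⟨T, hT, h⟩ := hc.exists_finite g
  exact ⟨hc.measurableSet_eq g, T, hT, h.self_of_nhds⟩

/-- The induced cocycle `g ↦ (y ↦ b (c(g, y)))`. -/
noncomputable def inducedCocycle (hc : IsInducingCocycle m D c) [IsFiniteMeasure m] (p : ℝ≥0∞)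
    (b : Γ → E) (g : G) : Lp E p m :=
  ((hc.isFiniteMeasurable g).comp_memLp b).toLp _

theorem coeFn_inducedCocycle (hc : IsInducingCocycle m D c) [IsFiniteMeasure m]
    (b : Γ → E) (g : G) : hc.inducedCocycle p b g =ᵐ[m] fun y => b (c g y) :=
  MemLp.coeFn_toLp _

/-- Near `g₀` all values of `c` lie in a finite set, on which `b` is bounded, and the integrands
agree off `{c g ≠ c g₀}`, whose measure tends to zero. -/
theorem continuous_inducedCocycle (hc : IsInducingCocycle m D c) [IsFiniteMeasure m]
    [Fact (1 ≤ p)] (hp : p ≠ ∞) (b : Γ → E) : Continuous (hc.inducedCocycle p b) := by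
  rw [continuous_iff_continuousAt]
  intro g₀
  obtain ⟨T, hT, hcT⟩ := hc.exists_finite g₀
  obtain ⟨C, hC⟩ := (hT.image fun γ => ‖b γ‖).bddAbove
  refine tendsto_Lp_of_norm_le_indicator hp (B := fun g => {y | c g y ≠ c g₀ y}) (C := C + C) ?_
    (hc.tendsto_ne g₀)
  filter_upwards [hcT] with g hg
  filter_upwards [hc.coeFn_inducedCocycle (p := p) b g, hc.coeFn_inducedCocycle (p := p) b g₀,
    Lp.coeFn_sub (hc.inducedCocycle p b g) (hc.inducedCocycle p b g₀)] with y h1 h2 h3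
  rw [h3, Pi.sub_apply, h1, h2]
  by_cases hy : c g y = c g₀ y
  · simp [hy]
  · rw [indicator_of_mem (show y ∈ {y | c g y ≠ c g₀ y} from hy)]
    refine (norm_sub_le _ _).trans ((add_le_add ?_ ?_).trans (le_abs_self _))
    · exact hC (mem_image_of_mem _ (hg y))
    · exact hC (mem_image_of_mem _ (hcT.self_of_nhds y))

theorem isCompact_closure_inducedCocycle [T2Space G] (hc : IsInducingCocycle m D c)
    [IsFiniteMeasure m]
    [Fact (1 ≤ p)] (hm : m univ ≠ 0) {b : Γ → E}
    (hb : ∀ C : ℝ, {γ | γ ∈ D ∧ ‖b γ‖ ≤ C}.Finite) (C : ℝ) :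
    IsCompact (closure {g | ‖hc.inducedCocycle p b g‖ ≤ C}) := by
  have hm' : (m univ ^ (1 / p.toReal)) ≠ 0 := by
    simp [hm, measure_ne_top]
  have hm'' : (m univ ^ (1 / p.toReal)) ≠ ∞ :=
    ENNReal.rpow_ne_top_of_nonneg (by positivity) (measure_ne_top _ _)
  set M := (m univ ^ (1 / p.toReal)).toReal
  have hM : 0 < M := ENNReal.toReal_pos hm' hm''
  -- `M` is the norm of the constant function `1`, so a function of norm at least `C'` everywhere
  -- has `L^p`-norm at least `|C| + 1 > C`.
  set C' := (|C| + 1) / M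
  refine (hc.isCompact_closure _ (hb C')).of_isClosed_subset isClosed_closure
    (closure_mono fun g hg => ?_)
  by_contra hcon
  simp only [mem_ofPred_eq, not_exists, not_and, not_le] at hcon
  have h1 : ∀ y, C' ≤ ‖b (c g y)‖ := fun y => (hcon y (hc.mem g y)).le
  have h2 : eLpNorm (fun _ : Y => C') p m ≤ eLpNorm (hc.inducedCocycle p b g) p m := by
    refine eLpNorm_mono_ae ?_
    filter_upwards [hc.coeFn_inducedCocycle (p := p) b g] with y hy
    rw [hy, Real.norm_of_nonneg (by positivity)]
    exact h1 y
  rw [eLpNorm_const _ (zero_lt_one.trans_le (Fact.out : 1 ≤ p)).ne' (by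
    rintro rfl
    simp at hm)] at h2
  have h3 := ENNReal.toReal_mono (Lp.eLpNorm_ne_top _) h2
  rw [ENNReal.toReal_mul, ← Lp.norm_def, toReal_enorm, Real.norm_of_nonneg (by positivity)] at h3
  have h4 : C' * M = |C| + 1 := div_mul_cancel₀ _ hM.ne'
  have h5 : ‖hc.inducedCocycle p b g‖ ≤ C := hg
  have := le_abs_self C
  change C' * M ≤ _ at h3
  linarith

variable [NormedSpace ℝ E] [Fact (1 ≤ p)]
  (hm : ∀ g : G, MeasurePreserving (fun y : Y => g • y) m m)

/-- The induced isometry `f ↦ (y ↦ π (c(g, y)) f(g⁻¹ y))`. -/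
noncomputable def inducedRep (hc : IsInducingCocycle m D c)
    (hm : ∀ g : G, MeasurePreserving (fun y : Y => g • y) m m) (p : ℝ≥0∞) [Fact (1 ≤ p)]
    (π : Γ → E ≃ₗᵢ[ℝ] E) (g : G) : Lp E p m ≃ₗᵢ[ℝ] Lp E p m :=
  LinearIsometryEquiv.ofSurjective
    ((twist m p (hc.isFiniteMeasurable g) π).comp (Lp.compMeasurePreservingₗᵢ ℝ _ (hm g⁻¹)))
    ((twist_surjective (hc.isFiniteMeasurable g) π).comp (compMeasurePreserving_smul_surjective hm g⁻¹))

theorem coeFn_inducedRep (hc : IsInducingCocycle m D c) (π : Γ → E ≃ₗᵢ[ℝ] E) (g : G)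
    (f : Lp E p m) : hc.inducedRep hm p π g f =ᵐ[m] fun y => π (c g y) (f (g⁻¹ • y)) := by
  filter_upwards [coeFn_twist (hc.isFiniteMeasurable g) π
    (Lp.compMeasurePreservingₗᵢ ℝ _ (hm g⁻¹) f),
    Lp.coeFn_compMeasurePreserving f (hm g⁻¹)] with y h1 h2
  exact h1.trans (congrArg (π (c g y)) h2)

theorem inducedRep_mul (hc : IsInducingCocycle m D c) {π : Γ → E ≃ₗᵢ[ℝ] E}
    (hπ : ∀ γ δ, π (γ * δ) = π γ * π δ) (g h : G) :
    hc.inducedRep hm p π (g * h) = hc.inducedRep hm p π g * hc.inducedRep hm p π h := by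
  ext1 f
  refine Lp.ext ?_
  filter_upwards [hc.coeFn_inducedRep hm π (g * h) f,
    hc.coeFn_inducedRep hm π g (hc.inducedRep hm p π h f),
    (hm g⁻¹).quasiMeasurePreserving.ae (hc.coeFn_inducedRep hm π h f)] with y h1 h2 h3
  rw [h1, LinearIsometryEquiv.coe_mul, Function.comp, h2, h3, hc.map_mul, hπ, mul_inv_rev,
    mul_smul]
  rfl

/-- For the indicator of `A` the two integrands agree unless `c` changes or `A` is moved, both on
sets of small measure. Since the operators are isometries, continuity passes to uniform limits of
orbit maps. -/
theorem continuous_inducedRep (hc : IsInducingCocycle m D c) (hp : p ≠ ∞)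
    (π : Γ → E ≃ₗᵢ[ℝ] E) (f : Lp E p m) : Continuous fun g => hc.inducedRep hm p π g f := by
  induction f using Lp.induction hp with
  | indicatorConst v hs hμs =>
    rename_i A
    have h0 : (Lp.simpleFunc.indicatorConst p hs hμs.ne v : Lp E p m) =ᵐ[m]
        A.indicator fun _ => v := by
      rw [Lp.simpleFunc.coe_indicatorConst]
      exact indicatorConstLp_coeFn
    generalize (Lp.simpleFunc.indicatorConst p hs hμs.ne v : Lp E p m) = w at h0
    have hcoe : ∀ g : G, hc.inducedRep hm p π g w =ᵐ[m] fun y =>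
        π (c g y) (A.indicator (fun _ => v) (g⁻¹ • y)) := by
      intro g
      filter_upwards [hc.coeFn_inducedRep hm π g w,
        (hm g⁻¹).quasiMeasurePreserving.ae h0] with y h1 h2
      rw [h1, h2]
    rw [continuous_iff_continuousAt]
    intro g₀
    refine tendsto_Lp_of_norm_le_indicator hp (B := fun g => {y | c g y ≠ c g₀ y} ∪
      symmDiff ((fun y => g⁻¹ • y) ⁻¹' A) ((fun y => g₀⁻¹ • y) ⁻¹' A)) (C := ‖v‖ + ‖v‖)
      (Filter.Eventually.of_forall fun g => ?_) ?_
    · filter_upwards [hcoe g, hcoe g₀, Lp.coeFn_sub (hc.inducedRep hm p π g w)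
        (hc.inducedRep hm p π g₀ w)] with y h1 h2 h3
      rw [h3, Pi.sub_apply, h1, h2]
      by_cases hy : y ∈ {y | c g y ≠ c g₀ y} ∪
          symmDiff ((fun y => g⁻¹ • y) ⁻¹' A) ((fun y => g₀⁻¹ • y) ⁻¹' A)
      · rw [indicator_of_mem hy]
        refine (norm_sub_le _ _).trans ((add_le_add ?_ ?_).trans (le_abs_self _)) <;>
        · rw [LinearIsometryEquiv.norm_map]
          exact norm_indicator_le_norm_self _ _
      · simp only [mem_union, mem_ofPred_eq, ne_eq, not_or, not_not, mem_symmDiff,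
          mem_preimage] at hy
        have h4 : g⁻¹ • y ∈ A ↔ g₀⁻¹ • y ∈ A := by tauto
        have h5 : A.indicator (fun _ => v) (g⁻¹ • y) = A.indicator (fun _ => v) (g₀⁻¹ • y) := by
          classical
          simp only [indicator_apply, h4]
        rw [hy.1, h5, sub_self, norm_zero]
        exact norm_nonneg _
    · refine tendsto_of_tendsto_of_tendsto_of_le_of_le tendsto_const_nhds
        (by simpa using (hc.tendsto_ne g₀).add (hc.tendsto_symmDiff A hs g₀))
        (fun _ => zero_le) fun g => measure_union_le _ _
  | add hf hg _ ihf ihg =>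
    simp only [map_add]
    exact ihf.add ihg
  | isClosed =>
    rw [← closure_subset_iff_isClosed]
    intro f hf
    refine continuous_of_uniform_approx_of_continuous fun u hu => ?_
    obtain ⟨ε, hε, hεu⟩ := Metric.mem_uniformity_dist.1 hu
    obtain ⟨f', hf', hff'⟩ := Metric.mem_closure_iff.1 hf ε hε
    refine ⟨_, hf', fun g => hεu ?_⟩
    rwa [LinearIsometryEquiv.dist_map]

/-- By the cocycle identity of `c`, the induced defect at `y` is a defect of `(π, b)`; bounds and
vanishing transfer pointwise. -/
theorem coeFn_inducedCocycle_defect [IsFiniteMeasure m] (hc : IsInducingCocycle m D c)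
    (π : Γ → E ≃ₗᵢ[ℝ] E) (b : Γ → E) (g h : G) :
    (hc.inducedCocycle p b (g * h) - hc.inducedCocycle p b g -
      hc.inducedRep hm p π g (hc.inducedCocycle p b h) : Lp E p m) =ᵐ[m] fun y =>
      b (c g y * c h (g⁻¹ • y)) - b (c g y) - π (c g y) (b (c h (g⁻¹ • y))) := by
  filter_upwards [Lp.coeFn_sub (hc.inducedCocycle p b (g * h) - hc.inducedCocycle p b g)
      (hc.inducedRep hm p π g (hc.inducedCocycle p b h)),
    Lp.coeFn_sub (hc.inducedCocycle p b (g * h)) (hc.inducedCocycle p b g),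
    hc.coeFn_inducedCocycle (p := p) b (g * h), hc.coeFn_inducedCocycle (p := p) b g,
    hc.coeFn_inducedRep hm π g (hc.inducedCocycle p b h),
    (hm g⁻¹).quasiMeasurePreserving.ae (hc.coeFn_inducedCocycle (p := p) b h)]
    with y h1 h2 h3 h4 h5 h6
  rw [h1, Pi.sub_apply, h2, Pi.sub_apply, h3, h4, h5, h6, hc.map_mul]

end IsInducingCocycle

/-! ### Vector-valued `L^p`-spaces over `L^p`-spaces -/

/-- A countably generated measurable space maps to a standard Borel space in such a way that
all measurable sets are preimages. -/
theorem exists_measurable_map_standardBorel (Y : Type u) [MeasurableSpace Y]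
    [MeasurableSpace.CountablyGenerated Y] :
    ∃ (Z : Type u) (_ : MeasurableSpace Z) (_ : StandardBorelSpace Z) (φ : Y → Z),
      Measurable φ ∧ ∀ A, MeasurableSet A → ∃ B, MeasurableSet B ∧ φ ⁻¹' B = A := by
  have : DiscreteMeasurableSpace (ULift.{u} Bool) :=
    ⟨fun s => MeasurableSet.of_discrete (s := ULift.up ⁻¹' s)⟩
  have : Countable (ULift.{u} Bool) := inferInstance
  have : StandardBorelSpace (ULift.{u} Bool) := inferInstance
  -- Records membership in a countable generating sequence. `ULift` keeps the Cantor space in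
  -- universe `u`; injectivity is not needed.
  set φ : Y → ℕ → ULift.{u} Bool := fun y n => ULift.up (MeasurableSpace.mapNatBool Y y n)
  have hφ : Measurable φ := measurable_pi_iff.2 fun n =>
    measurable_up.comp ((measurable_pi_iff.1 (MeasurableSpace.measurable_mapNatBool Y)) n)
  refine ⟨ℕ → ULift.{u} Bool, inferInstance, inferInstance, φ, hφ, fun A hA => ?_⟩
  rw [← MeasurableSpace.generateFrom_natGeneratingSequence Y] at hA
  have hA' : MeasurableSet[MeasurableSpace.comap φ inferInstance] A := by
    refine MeasurableSpace.generateFrom_le ?_ A hA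
    rintro _ ⟨n, rfl⟩
    refine ⟨{z | (z n).down = true}, ?_, ?_⟩
    · exact measurable_pi_apply (X := fun _ => ULift.{u} Bool) n
        (MeasurableSet.of_discrete (s := {b : ULift.{u} Bool | b.down = true}))
    · ext y
      simp [φ, MeasurableSpace.mapNatBool]
  exact hA'

/-- A closed subspace of `L^p` that contains the indicators of `R ∩ T` for the sets `R` of a
generating π-system contains the indicators of `A ∩ T` for all measurable sets `A`. -/
theorem indicatorConstLp_mem_of_isPiSystem {X E : Type*} [mX : MeasurableSpace X]
    {ρ : Measure X} [NormedAddCommGroup E] [NormedSpace ℝ E] {p : ℝ≥0∞} [Fact (1 ≤ p)] (hp : p ≠ ∞)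
    {S : Submodule ℝ (Lp E p ρ)}
    (hS : IsClosed (S : Set (Lp E p ρ))) (v : E) {T : Set X} (hT : MeasurableSet T)
    (hρT : ρ T ≠ ∞) {𝒞 : Set (Set X)} (hgen : mX = MeasurableSpace.generateFrom 𝒞)
    (hpi : IsPiSystem 𝒞) (huniv : indicatorConstLp p hT hρT v ∈ S)
    (hR : ∀ R ∈ 𝒞, ∀ hR : MeasurableSet R, indicatorConstLp p (hR.inter hT)
      (measure_inter_ne_top_of_right_ne_top hρT) v ∈ S)
    (A : Set X) (hA : MeasurableSet A) :
    indicatorConstLp p (hA.inter hT) (measure_inter_ne_top_of_right_ne_top hρT) v ∈ S := by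
  have hfin : ∀ A : Set X, ρ (A ∩ T) ≠ ∞ := fun A => measure_inter_ne_top_of_right_ne_top hρT
  induction A, hA using MeasurableSpace.induction_on_inter hgen hpi with
  | empty =>
    convert S.zero_mem
    simp only [empty_inter]
    exact indicatorConstLp_empty
  | basic R hRC => exact hR R hRC (hgen ▸ .basic R hRC)
  | compl A hA ih =>
    convert S.sub_mem huniv ih using 1
    rw [eq_sub_iff_add_eq, ← indicatorConstLp_disjoint_union (hA.compl.inter hT) (hA.inter hT)
      (hfin _) (hfin _) (disjoint_compl_left.mono inter_subset_left inter_subset_left)]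
    congr 1
    rw [← union_inter_distrib_right, compl_union_self, univ_inter]
  | iUnion f hdisj hf ih =>
    have hfm : ∀ n : ℕ, MeasurableSet (⋃ i ∈ Finset.range n, f i) := fun n =>
      Finset.measurableSet_biUnion _ fun i _ => hf i
    have hpart : ∀ n : ℕ, indicatorConstLp p ((hfm n).inter hT) (hfin _) v ∈ S := by
      intro n
      induction n with
      | zero =>
        convert S.zero_mem
        simp only [Finset.range_zero, Finset.notMem_empty, iUnion_of_empty, iUnion_empty,
          empty_inter]
        exact indicatorConstLp_empty
      | succ n ihn =>
        convert S.add_mem ihn (ih n) using 1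
        rw [← indicatorConstLp_disjoint_union ((hfm n).inter hT) ((hf n).inter hT)
          (hfin _) (hfin _)]
        · congr 1
          rw [← union_inter_distrib_right, Finset.range_add_one, Finset.set_biUnion_insert,
            union_comm]
        · refine Disjoint.mono inter_subset_left inter_subset_left ?_
          refine disjoint_iUnion₂_left.2 fun i hi => hdisj ?_
          exact (Finset.mem_range.1 hi).ne
    refine hS.mem_of_tendsto (tendsto_indicatorConstLp_set (t := fun n : ℕ =>
      (⋃ i ∈ Finset.range n, f i) ∩ T) (ht := fun n => (hfm n).inter hT) (hμt := fun n => hfin _)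
      (l := Filter.atTop) hp ?_) (Filter.Eventually.of_forall hpart)
    rw [← measure_empty (μ := ρ)]
    have hsub : ∀ n : ℕ, symmDiff ((⋃ i ∈ Finset.range n, f i) ∩ T) ((⋃ i, f i) ∩ T) ⊆ T := by
      intro n x hx
      rcases hx with hx | hx
      · exact hx.1.2
      · exact hx.1.2
    refine tendsto_measure_of_tendsto_indicator _ (fun n => ((hfm n).inter hT).symmDiff
      ((MeasurableSet.iUnion hf).inter hT)) hT hρT (Filter.Eventually.of_forall hsub) fun x => ?_
    by_cases hx : x ∈ ⋃ i, f i
    · obtain ⟨i, hi⟩ := mem_iUnion.1 hx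
      filter_upwards [Filter.eventually_gt_atTop i] with n hn
      have : x ∈ ⋃ i ∈ Finset.range n, f i := mem_iUnion₂.2 ⟨i, Finset.mem_range.2 hn, hi⟩
      simp only [mem_symmDiff, mem_inter_iff, this, hx, mem_empty_iff_false]
      tauto
    · refine Filter.Eventually.of_forall fun n => ?_
      have : x ∉ ⋃ i ∈ Finset.range n, f i := fun h =>
        hx (iUnion₂_subset (fun i _ => subset_iUnion f i) h)
      simp only [mem_symmDiff, mem_inter_iff, this, hx, mem_empty_iff_false]
      tauto

theorem continuous_indicatorConstLp {X E : Type*} [MeasurableSpace X] {ρ : Measure X}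
    [NormedAddCommGroup E] {p : ℝ≥0∞} [Fact (1 ≤ p)] {A : Set X} (hA : MeasurableSet A)
    (hρA : ρ A ≠ ∞) : Continuous fun v : E => indicatorConstLp p hA hρA v := by
  refine (LipschitzWith.of_dist_le_mul (K := ⟨ρ.real A ^ (1 / p.toReal), by positivity⟩)
    fun v w => ?_).continuous
  rw [dist_eq_norm, dist_eq_norm, indicatorConstLp_sub]
  refine norm_indicatorConstLp_le.trans (le_of_eq ?_)
  rw [mul_comm]
  rfl

theorem indicatorConstLp_smul {X E : Type*} [MeasurableSpace X] {ρ : Measure X}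
    [NormedAddCommGroup E] [NormedSpace ℝ E] {p : ℝ≥0∞}
    {A : Set X} (hA : MeasurableSet A) (hρA : ρ A ≠ ∞) (r : ℝ) (v : E) :
    indicatorConstLp p hA hρA (r • v) = r • indicatorConstLp p hA hρA v := by
  refine Lp.ext ?_
  filter_upwards [indicatorConstLp_coeFn (p := p) (hs := hA) (hμs := hρA) (c := r • v),
    Lp.coeFn_smul r (indicatorConstLp p hA hρA v),
    indicatorConstLp_coeFn (p := p) (hs := hA) (hμs := hρA) (c := v)] with x h1 h2 h3
  rw [h1, h2, Pi.smul_apply, h3]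
  by_cases hx : x ∈ A <;> simp [hx]

theorem indicatorConstLp_eq_smul {X : Type*} [MeasurableSpace X] {ρ : Measure X} {p : ℝ≥0∞}
    {A : Set X} (hA : MeasurableSet A) (hρA : ρ A ≠ ∞) (r : ℝ) :
    indicatorConstLp p hA hρA r = r • indicatorConstLp p hA hρA (1 : ℝ) := by
  rw [← indicatorConstLp_smul, smul_eq_mul, mul_one]

/-! ### Elementary tensors in `L^p(Y; E)` and in `L^p` of the product -/

section Tensor

variable {Y Z Ω E : Type*} [MeasurableSpace Y] [MeasurableSpace Z] [MeasurableSpace Ω]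
  {m : Measure Y} [IsFiniteMeasure m] {μ : Measure Ω} [SigmaFinite μ]
  [NormedAddCommGroup E] [NormedSpace ℝ E] {p : ℝ≥0∞} [Fact (1 ≤ p)]
  {φ : Y → Z}

/-- Pairs of a measurable subset of `Z` and a measurable subset of `Ω` of finite measure. -/
abbrev RectIndex (Z : Type*) {Ω : Type*} [MeasurableSpace Z] [MeasurableSpace Ω]
    (μ : Measure Ω) : Type _ :=
  {A : Set Z // MeasurableSet A} × {B : Set Ω // MeasurableSet B ∧ μ B ≠ ∞}

/-- Combinations of elementary tensors, as functions with values in `L^p(Ω)`. -/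
noncomputable def rectVec (p : ℝ≥0∞) [Fact (1 ≤ p)] (μ : Measure Ω) (z : Z) :
    (RectIndex Z μ →₀ ℝ) →ₗ[ℝ] Lp ℝ p μ :=
  Finsupp.linearCombination ℝ fun i =>
    i.1.1.indicator (fun _ => indicatorConstLp p i.2.2.1 i.2.2.2 (1 : ℝ)) z

/-- Combinations of elementary tensors, as functions on the product space. -/
noncomputable def rectFun (μ : Measure Ω) (w : Z × Ω) : (RectIndex Z μ →₀ ℝ) →ₗ[ℝ] ℝ :=
  Finsupp.linearCombination ℝ fun i => (i.1.1 ×ˢ i.2.1).indicator (fun _ => (1 : ℝ)) w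

omit [SigmaFinite μ] in
theorem rectVec_ae (z : Z) (x : RectIndex Z μ →₀ ℝ) :
    rectVec p μ z x =ᵐ[μ] fun ω => rectFun μ (z, ω) x := by
  induction x using Finsupp.induction_linear with
  | zero =>
    simp only [map_zero]
    exact Lp.coeFn_zero _ _ _
  | add x y hx hy =>
    simp only [map_add]
    filter_upwards [Lp.coeFn_add (rectVec p μ z x) (rectVec p μ z y), hx, hy] with ω h1 h2 h3
    rw [h1, Pi.add_apply, h2, h3]
  | single i a =>
    simp only [rectVec, rectFun, Finsupp.linearCombination_single]
    by_cases hz : z ∈ i.1.1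
    · rw [indicator_of_mem hz]
      filter_upwards [Lp.coeFn_smul a (indicatorConstLp p i.2.2.1 i.2.2.2 (1 : ℝ)),
        indicatorConstLp_coeFn (p := p) (hs := i.2.2.1) (hμs := i.2.2.2) (c := (1 : ℝ))]
        with ω h1 h2
      rw [h1, Pi.smul_apply, h2]
      by_cases hω : ω ∈ i.2.1 <;> simp [hω, hz]
    · rw [indicator_of_notMem hz, smul_zero]
      filter_upwards [Lp.coeFn_zero ℝ p μ] with ω h1
      rw [h1]
      simp [hz]

omit [SigmaFinite μ] in
theorem measurable_rectFun (x : RectIndex Z μ →₀ ℝ) : Measurable fun w => rectFun μ w x := by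
  induction x using Finsupp.induction_linear with
  | zero => simp
  | add x y hx hy =>
    simp only [map_add]
    exact hx.add hy
  | single i a =>
    simp only [rectFun, Finsupp.linearCombination_single]
    exact (measurable_const.indicator (i.1.2.prod i.2.2.1)).const_smul a

/-- Combinations of elementary tensors in `L^p(Y; E)`. -/
noncomputable def rectLpVec (m : Measure Y) [IsFiniteMeasure m] (hφ : Measurable φ)
    (e : Lp ℝ p μ →ₗᵢ[ℝ] E) : (RectIndex Z μ →₀ ℝ) →ₗ[ℝ] Lp E p m :=
  Finsupp.linearCombination ℝ fun i => indicatorConstLp p (hφ i.1.2) (measure_ne_top m _)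
    (e (indicatorConstLp p i.2.2.1 i.2.2.2 (1 : ℝ)))

omit [SigmaFinite μ] in
theorem rectLpVec_ae (hφ : Measurable φ) (e : Lp ℝ p μ →ₗᵢ[ℝ] E) (x : RectIndex Z μ →₀ ℝ) :
    rectLpVec m hφ e x =ᵐ[m] fun y => e (rectVec p μ (φ y) x) := by
  induction x using Finsupp.induction_linear with
  | zero =>
    simp only [map_zero]
    exact Lp.coeFn_zero _ _ _
  | add x y hx hy =>
    simp only [map_add]
    filter_upwards [Lp.coeFn_add (rectLpVec m hφ e x) (rectLpVec m hφ e y), hx, hy] with z h1 h2 h3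
    rw [h1, Pi.add_apply, h2, h3]
  | single i a =>
    simp only [rectLpVec, rectVec, Finsupp.linearCombination_single]
    filter_upwards [Lp.coeFn_smul a (indicatorConstLp p (hφ i.1.2) (measure_ne_top m _)
        (e (indicatorConstLp p i.2.2.1 i.2.2.2 (1 : ℝ)))),
      indicatorConstLp_coeFn (p := p) (hs := hφ i.1.2) (hμs := measure_ne_top m _)
        (c := e (indicatorConstLp p i.2.2.1 i.2.2.2 (1 : ℝ)))] with y h1 h2
    rw [h1, Pi.smul_apply, h2]
    by_cases hy : φ y ∈ i.1.1 <;> simp [hy]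

theorem measure_rect_ne_top (i : RectIndex Z μ) : (m.map φ).prod μ (i.1.1 ×ˢ i.2.1) ≠ ∞ := by
  rw [Measure.prod_prod]
  exact ENNReal.mul_ne_top (measure_ne_top _ _) i.2.2.2

/-- Combinations of elementary tensors in `L^p` of the product space. -/
noncomputable def rectLpFun (m : Measure Y) [IsFiniteMeasure m] (φ : Y → Z) (μ : Measure Ω)
    [SigmaFinite μ] (p : ℝ≥0∞) [Fact (1 ≤ p)] :
    (RectIndex Z μ →₀ ℝ) →ₗ[ℝ] Lp ℝ p ((m.map φ).prod μ) :=
  Finsupp.linearCombination ℝ fun i => indicatorConstLp p (i.1.2.prod i.2.2.1)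
    (measure_rect_ne_top i) (1 : ℝ)

theorem rectLpFun_ae (x : RectIndex Z μ →₀ ℝ) :
    rectLpFun m φ μ p x =ᵐ[(m.map φ).prod μ] fun w => rectFun μ w x := by
  induction x using Finsupp.induction_linear with
  | zero =>
    simp only [map_zero]
    exact Lp.coeFn_zero _ _ _
  | add x y hx hy =>
    simp only [map_add]
    filter_upwards [Lp.coeFn_add (rectLpFun m φ μ p x) (rectLpFun m φ μ p y), hx, hy]
      with z h1 h2 h3
    rw [h1, Pi.add_apply, h2, h3]
  | single i a =>
    simp only [rectLpFun, rectFun, Finsupp.linearCombination_single]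
    filter_upwards [Lp.coeFn_smul a (indicatorConstLp p (i.1.2.prod i.2.2.1)
        (measure_rect_ne_top (m := m) (φ := φ) i) (1 : ℝ)),
      indicatorConstLp_coeFn (p := p) (hs := i.1.2.prod i.2.2.1)
        (hμs := measure_rect_ne_top (m := m) (φ := φ) i) (c := (1 : ℝ))] with y h1 h2
    rw [h1, Pi.smul_apply, h2]

/-- Tonelli: the `p`-th power of the norm of the value at `y` is the inner integral over `Ω`, and
the outer integral is transported along `φ`. -/
theorem norm_rectLpVec (hp : p ≠ ∞) (hφ : Measurable φ) (e : Lp ℝ p μ →ₗᵢ[ℝ] E)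
    (x : RectIndex Z μ →₀ ℝ) : ‖rectLpVec m hφ e x‖ = ‖rectLpFun m φ μ p x‖ := by
  have hp0 : p ≠ 0 := (zero_lt_one.trans_le (Fact.out : 1 ≤ p)).ne'
  have hpr : p.toReal ≠ 0 := (ENNReal.toReal_pos hp0 hp).ne'
  have hmeas : Measurable fun w : Z × Ω => ‖rectFun μ w x‖ₑ ^ p.toReal :=
    (measurable_rectFun x).enorm.pow_const _
  rw [Lp.norm_def, Lp.norm_def, eLpNorm_congr_ae (rectLpVec_ae hφ e x),
    eLpNorm_congr_ae (rectLpFun_ae x), eLpNorm_eq_lintegral_rpow_enorm_toReal hp0 hp,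
    eLpNorm_eq_lintegral_rpow_enorm_toReal hp0 hp, lintegral_prod _ hmeas.aemeasurable,
    lintegral_map hmeas.lintegral_prod_right' hφ]
  congr 3
  ext y
  rw [LinearIsometry.enorm_map, Lp.enorm_def, eLpNorm_congr_ae (rectVec_ae (φ y) x),
    eLpNorm_eq_lintegral_rpow_enorm_toReal hp0 hp, ← ENNReal.rpow_mul, one_div,
    inv_mul_cancel₀ hpr, ENNReal.rpow_one]

omit [SigmaFinite μ] in
-- Every measurable subset of `Y` is a preimage under `φ`, so indicators with simple values are
-- available, and these span a dense subspace.
theorem denseRange_rectLpVec (hp : p ≠ ∞) (hφ : Measurable φ)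
    (hφs : ∀ A, MeasurableSet A → ∃ B, MeasurableSet B ∧ φ ⁻¹' B = A) (e : Lp ℝ p μ ≃ₗᵢ[ℝ] E) :
    DenseRange (rectLpVec m hφ e.toLinearIsometry) := by
  set S := (LinearMap.range (rectLpVec m hφ e.toLinearIsometry)).topologicalClosure
  have hSc : IsClosed (S : Set (Lp E p m)) := Submodule.isClosed_topologicalClosure _
  have hind : ∀ (A : Set Y) (hA : MeasurableSet A) (v : Lp ℝ p μ),
      indicatorConstLp p hA (measure_ne_top m _) (e v) ∈ S := by
    intro A hA v
    obtain ⟨A, hA', rfl⟩ := hφs A hA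
    induction v using Lp.induction hp with
    | indicatorConst r hs hμs =>
      rename_i B
      rw [Lp.simpleFunc.coe_indicatorConst]
      refine Submodule.le_topologicalClosure _
        ⟨Finsupp.single (⟨A, hA'⟩, ⟨B, hs, hμs.ne⟩) r, ?_⟩
      simp only [rectLpVec, Finsupp.linearCombination_single]
      rw [indicatorConstLp_eq_smul hs hμs.ne r, map_smul, indicatorConstLp_smul]
      rfl
    | add hf hg _ ihf ihg =>
      rw [map_add, ← indicatorConstLp_add]
      exact S.add_mem ihf ihg
    | isClosed =>
      exact hSc.preimage ((continuous_indicatorConstLp hA (measure_ne_top m _)).comp e.continuous)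
  have htop : ∀ f : Lp E p m, f ∈ S := by
    intro f
    induction f using Lp.induction hp with
    | indicatorConst v hs hμs =>
      rw [Lp.simpleFunc.coe_indicatorConst]
      simpa using hind _ hs (e.symm v)
    | add hf hg _ ihf ihg => exact S.add_mem ihf ihg
    | isClosed => exact hSc
  exact fun f => htop f

/-- Rectangles form a generating π-system. The π-λ argument runs inside the finite-measure strips `T
n`, which then exhaust the product. -/
theorem denseRange_rectLpFun (hp : p ≠ ∞) : DenseRange (rectLpFun m φ μ p) := by
  set ρ := (m.map φ).prod μ
  set S := (LinearMap.range (rectLpFun m φ μ p)).topologicalClosure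
  have hSc : IsClosed (S : Set (Lp ℝ p ρ)) := Submodule.isClosed_topologicalClosure _
  have hsp : ∀ n, μ (spanningSets μ n) ≠ ∞ := fun n => (measure_spanningSets_lt_top μ n).ne
  have hspm : ∀ n, MeasurableSet (spanningSets μ n) := measurableSet_spanningSets μ
  set T : ℕ → Set (Z × Ω) := fun n => univ ×ˢ spanningSets μ n
  have hT : ∀ n, MeasurableSet (T n) := fun n => MeasurableSet.univ.prod (hspm n)
  have hρT : ∀ n, ρ (T n) ≠ ∞ := fun n =>
    measure_rect_ne_top (m := m) (φ := φ) (⟨univ, MeasurableSet.univ⟩, ⟨_, hspm n, hsp n⟩)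
  have hrect : ∀ (i : RectIndex Z μ) (R : Set (Z × Ω)) (hR : MeasurableSet R) (hρR : ρ R ≠ ∞),
      R = i.1.1 ×ˢ i.2.1 → indicatorConstLp p hR hρR (1 : ℝ) ∈ S := by
    rintro i _ hR hρR rfl
    refine Submodule.le_topologicalClosure _ ⟨Finsupp.single i 1, ?_⟩
    simp only [rectLpFun, Finsupp.linearCombination_single, one_smul]
  have hloc : ∀ (n : ℕ) (A : Set (Z × Ω)) (hA : MeasurableSet A),
      indicatorConstLp p (hA.inter (hT n)) (measure_inter_ne_top_of_right_ne_top (hρT n))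
        (1 : ℝ) ∈ S := by
    intro n
    refine indicatorConstLp_mem_of_isPiSystem hp hSc 1 (hT n) (hρT n) generateFrom_prod.symm
      isPiSystem_prod (hrect (⟨univ, MeasurableSet.univ⟩, ⟨_, hspm n, hsp n⟩) _ _ _ rfl) ?_
    rintro _ ⟨A, hA, B, hB, rfl⟩ hR
    refine hrect (⟨A, hA⟩, ⟨B ∩ spanningSets μ n, hB.inter (hspm n),
      measure_inter_ne_top_of_right_ne_top (hsp n)⟩) _ _ _ ?_
    simp only [T]
    rw [prod_inter_prod, inter_univ]
  have hind : ∀ (A : Set (Z × Ω)) (hA : MeasurableSet A) (hρA : ρ A ≠ ∞),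
      indicatorConstLp p hA hρA (1 : ℝ) ∈ S := by
    intro A hA hρA
    refine hSc.mem_of_tendsto (tendsto_indicatorConstLp_set (t := fun n : ℕ => A ∩ T n)
      (ht := fun n => hA.inter (hT n)) (hμt := fun n =>
        measure_inter_ne_top_of_right_ne_top (hρT n)) (l := Filter.atTop) hp ?_)
      (Filter.Eventually.of_forall fun n => hloc n A hA)
    rw [← measure_empty (μ := ρ)]
    refine tendsto_measure_of_tendsto_indicator _
      (fun n => (hA.inter (hT n)).symmDiff hA) hA hρA (Filter.Eventually.of_forall fun n x hx => ?_)
      fun x => ?_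
    · rcases hx with hx | hx
      · exact hx.1.1
      · exact hx.1
    · have hx : x.2 ∈ ⋃ n, spanningSets μ n := by simp [iUnion_spanningSets]
      obtain ⟨k, hk⟩ := mem_iUnion.1 hx
      filter_upwards [Filter.eventually_ge_atTop k] with n hn
      have : x ∈ T n := ⟨mem_univ _, spanningSets_mono hn hk⟩
      simp only [mem_symmDiff, mem_inter_iff, this, mem_empty_iff_false]
      tauto
  have htop : ∀ f : Lp ℝ p ρ, f ∈ S := by
    intro f
    induction f using Lp.induction hp with
    | indicatorConst r hs hμs =>
      rw [Lp.simpleFunc.coe_indicatorConst]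
      rename_i A
      rw [indicatorConstLp_eq_smul]
      exact S.smul_mem r (hind A hs hμs.ne)
    | add hf hg _ ihf ihg => exact S.add_mem ihf ihg
    | isClosed => exact hSc
  exact fun f => htop f

end Tensor

/-- The `L^p`-space of functions with values in an `L^p`-space is an `L^p`-space. -/
theorem IsLpSpace.Lp {Y E : Type u} [MeasurableSpace Y] [MeasurableSpace.CountablyGenerated Y]
    (m : Measure Y) [IsFiniteMeasure m] [NormedAddCommGroup E] [NormedSpace ℝ E] {p : ℝ≥0∞}
    [Fact (1 ≤ p)] (hp : p ≠ ∞) (hE : IsLpSpace p E) : IsLpSpace p (Lp E p m) := by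
  obtain ⟨Ω, _, _, μ, _, e, he⟩ := hE
  obtain ⟨Z, _, _, φ, hφ, hφs⟩ := exists_measurable_map_standardBorel Y
  let e' : E ≃ₗᵢ[ℝ] MeasureTheory.Lp ℝ p μ := ⟨e, he⟩
  have : CompleteSpace E := e'.toIsometryEquiv.completeSpace
  have hnorm : ∀ x, ‖rectLpVec m hφ e'.symm.toLinearIsometry x‖ = ‖rectLpFun m φ μ p x‖ :=
    norm_rectLpVec hp hφ _
  have hd₁ : DenseRange (rectLpVec m hφ e'.symm.toLinearIsometry) :=
    denseRange_rectLpVec hp hφ hφs e'.symm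
  have hd₂ : DenseRange (rectLpFun m φ μ p) := denseRange_rectLpFun hp
  -- The two maps from formal combinations of rectangles have equal norms and dense ranges, so the
  -- identity on combinations extends to an isometry of the completions.
  let Φ := (LinearEquiv.refl ℝ (RectIndex Z μ →₀ ℝ)).extend
    (rectLpVec m hφ e'.symm.toLinearIsometry) (rectLpFun m φ μ p) hd₁
    ⟨1, fun x => by simp [hnorm]⟩ hd₂ ⟨1, fun x => by simp [hnorm]⟩
  refine ⟨Z × Ω, inferInstance, inferInstance, (m.map φ).prod μ, inferInstance,
    Φ.toLinearEquiv, fun f => ?_⟩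
  refine hd₁.induction_on (p := fun f => ‖Φ f‖ = ‖f‖) f
    (isClosed_eq (by fun_prop) (by fun_prop)) fun x => ?_
  simp only [Φ, LinearEquiv.extend_eq, LinearEquiv.refl_apply, hnorm]

/-! ### Restriction and induction of Haagerup-type properties -/

section Pairs

variable {G : Type u} [TopologicalSpace G]

theorem isBorelMap_of_continuous {E : Type u} [NormedAddCommGroup E] [NormedSpace ℝ E]
    {π : G → (E ≃ₗᵢ[ℝ] E)} (h : ∀ v, Continuous fun g => π g v) : IsBorelMap π := by
  let _ := strongOperatorTopology E
  have hπ : Continuous π := continuous_induced_rng.2 (continuous_pi h)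
  exact hπ.borel_measurable

variable [Group G]

/-- A Haagerup-type property passes to locally finite subsets of the group. -/
theorem approxGroupHas_of_has {𝓗 : HaagerupType} {p : ℝ≥0∞} {S : Set G} (hS : LocFin S)
    (h : Has 𝓗 p G) : ApproxGroupHas 𝓗 p S := by
  obtain ⟨E, _, _, hE, π, b, hpair, hb⟩ := h
  let _ : TopologicalSpace (Subgroup.closure S) := ⊥
  have : DiscreteTopology (Subgroup.closure S) := ⟨rfl⟩
  have hm : ∀ {X : Type u} (mX : MeasurableSpace X) (f : Subgroup.closure S → X),
      @Measurable _ _ (borel _) mX f := fun mX f s _ =>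
    MeasurableSpace.measurableSet_generateFrom (show IsOpen (f ⁻¹' s) from isOpen_discrete _)
  have hwq : IsWQPair π b → IsWQPair (fun γ : Subgroup.closure S => π γ) (fun γ => b γ) :=
    fun h => ⟨hm _ _, hm _ _, h.bounded_defect.imp fun D hD g h => hD g h⟩
  refine ⟨E, _, _, hE, fun γ => π γ, fun γ => b γ, ?_, fun C hC => ?_⟩
  · cases 𝓗 with
    | aFLp =>
      have hpair : IsCocyclePair π b := hpair
      exact show IsCocyclePair _ _ from ⟨fun g h => hpair.map_mul g h,
        fun v => continuous_of_discreteTopology, continuous_of_discreteTopology,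
        fun g h => hpair.cocycle g h⟩
    | aFFLp =>
      have hpair : IsQuasiPair π b := hpair
      exact show IsQuasiPair _ _ from ⟨hwq hpair.toIsWQPair, fun g h => hpair.map_mul g h⟩
    | aFFFLp => exact show IsWQPair _ _ from hwq hpair
  · have hfin : {γ : Subgroup.closure S | (γ : G) ∈ S ∧ ‖b γ‖ ≤ C}.Finite := by
      refine ((hS _ (hb C hC)).preimage (Subtype.val_injective.injOn)).subset ?_
      rintro γ ⟨hγ, hγC⟩
      exact ⟨hγ, subset_closure ⟨mem_univ _, hγC⟩⟩
    exact hfin.isCompact.closure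

/-- Properness on `S` of an almost cocycle implies properness on finitely many right translates
of `S`. -/
theorem finite_setOf_norm_le_of_subset_mul {Γ E : Type*} [Group Γ] [NormedAddCommGroup E]
    [NormedSpace ℝ E] {π : Γ → (E ≃ₗᵢ[ℝ] E)} {b : Γ → E} {R : ℝ}
    (hR : ∀ g h, ‖b (g * h) - b g - π g (b h)‖ ≤ R) {S D F : Set Γ} (hF : F.Finite)
    (hD : D ⊆ S * F) (hS : ∀ C : ℝ, {γ | γ ∈ S ∧ ‖b γ‖ ≤ C}.Finite) (C : ℝ) :
    {γ | γ ∈ D ∧ ‖b γ‖ ≤ C}.Finite := by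
  obtain ⟨M, hM⟩ := (hF.image fun γ => ‖b γ‖).bddAbove
  -- From `‖b s‖ ≤ ‖b (s * f)‖ + R + ‖b f‖` with `‖b f‖ ≤ M` on `F`.
  refine ((hS (C + R + M)).mul hF).subset ?_
  rintro γ ⟨hγ, hγC⟩
  obtain ⟨s, hs, f, hf, rfl⟩ := hD hγ
  refine ⟨s, ⟨hs, ?_⟩, f, hf, rfl⟩
  have h1 : ‖b f‖ ≤ M := hM (mem_image_of_mem _ hf)
  have h2 : b s = b (s * f) - (b (s * f) - b s - π s (b f)) - π s (b f) := by abel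
  have h3 : ‖b s‖ ≤ ‖b (s * f)‖ + ‖b (s * f) - b s - π s (b f)‖ + ‖π s (b f)‖ := by
    conv_lhs => rw [h2]
    exact (norm_sub_le _ _).trans (add_le_add_left (norm_sub_le _ _) _)
  rw [LinearIsometryEquiv.norm_map] at h3
  have h4 := hR s f
  change ‖b (s * f)‖ ≤ C at hγC
  linarith

theorem HaagerupType.IsPair.exists_bound {𝓗 : HaagerupType} {E : Type u} [NormedAddCommGroup E]
    [NormedSpace ℝ E] {π : G → (E ≃ₗᵢ[ℝ] E)} {b : G → E} (h : 𝓗.IsPair π b) :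
    ∃ R : ℝ, ∀ g h, ‖b (g * h) - b g - π g (b h)‖ ≤ R := by
  cases 𝓗 with
  | aFLp =>
    have h : IsCocyclePair π b := h
    exact ⟨0, fun g k => by simp [h.cocycle]⟩
  | aFFLp => exact (show IsQuasiPair π b from h).bounded_defect
  | aFFFLp => exact (show IsWQPair π b from h).bounded_defect

/-- Affine actions and their weakenings can be induced along an inducing cocycle. -/
theorem IsInducingCocycle.isPair {Γ Y : Type u} [Group Γ] [TopologicalSpace Γ]
    [MeasurableSpace Y] [MulAction G Y] {m : Measure Y} [IsFiniteMeasure m]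
    (hm : ∀ g : G, MeasurePreserving (fun y : Y => g • y) m m)
    {D : Set Γ} {c : G → Y → Γ} (hc : IsInducingCocycle m D c) {p : ℝ≥0∞} [Fact (1 ≤ p)]
    (hp : p ≠ ∞) {𝓗 : HaagerupType} {E : Type u} [NormedAddCommGroup E] [NormedSpace ℝ E]
    {π : Γ → (E ≃ₗᵢ[ℝ] E)} {b : Γ → E} (h : 𝓗.IsPair π b) :
    𝓗.IsPair (hc.inducedRep hm p π) (hc.inducedCocycle p b) := by
  have hwq : IsWQPair (hc.inducedRep hm p π) (hc.inducedCocycle p b) := by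
    obtain ⟨R, hR⟩ := h.exists_bound
    -- Borel measurability comes from continuity, and the pointwise defect bound becomes an `L^p`
    -- bound because `m` is finite.
    refine ⟨isBorelMap_of_continuous (hc.continuous_inducedRep hm hp π),
      (hc.continuous_inducedCocycle hp b).borel_measurable, _, fun g k =>
        Lp.norm_le_of_ae_bound (C := |R|) (abs_nonneg R) ?_⟩
    filter_upwards [hc.coeFn_inducedCocycle_defect (p := p) hm π b g k] with y hy
    rw [hy]
    exact (hR _ _).trans (le_abs_self R)
  cases 𝓗 with
  | aFLp =>
    have h : IsCocyclePair π b := h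
    refine show IsCocyclePair _ _ from ⟨hc.inducedRep_mul hm h.map_mul,
      hc.continuous_inducedRep hm hp π, hc.continuous_inducedCocycle hp b, fun g k => ?_⟩
    rw [← sub_eq_zero, ← sub_sub]
    refine Lp.ext ?_
    filter_upwards [hc.coeFn_inducedCocycle_defect (p := p) hm π b g k, Lp.coeFn_zero E p m]
      with y hy h0
    rw [hy, h0, h.cocycle]
    simp
  | aFFLp =>
    have h : IsQuasiPair π b := h
    exact show IsQuasiPair _ _ from ⟨hwq, hc.inducedRep_mul hm h.map_mul⟩
  | aFFFLp => exact show IsWQPair _ _ from hwq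

end Pairs

/-- A Haagerup-type property of a relatively dense approximate subgroup of a strong uniform
approximate lattice passes to the ambient group. -/
theorem has_of_approxGroupHas {G : Type u} [Group G] [TopologicalSpace G] [IsTopologicalGroup G]
    [LocallyCompactSpace G] [SecondCountableTopology G] [T2Space G] {𝓗 : HaagerupType} {p : ℝ≥0∞}
    (hp : 1 ≤ p) (hp' : p ≠ ∞) {S L : Set G} (hS : IsUniformApproxLattice S)
    (hL : IsStrongUniformApproxLattice L) (hSL : S ⊆ L) (h : ApproxGroupHas 𝓗 p S) :
    Has 𝓗 p G := by
  have : Fact (1 ≤ p) := ⟨hp⟩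
  obtain ⟨K, hK, hSK⟩ := hS.delone.exists_compact
  have hLfin : LocFin L := hL.uniform.delone.locFin
  have hLa := hL.uniform.approxSubgroup
  have hLL : LocFin (L * L) := hLa.locFin_sq hLfin
  obtain ⟨ν, _, hν, hinv⟩ := hL.exists_measure
  obtain ⟨m, _, hm0, hm⟩ := exists_invariant_measure_pattern hLa hLL hK
    (fun P hP => exists_relativelyDense_classOf hLL hS.approxSubgroup hSL hK hSK hP) hν hinv
  obtain ⟨c, hc⟩ := Pattern.exists_isInducingCocycle (hLL.mono inter_subset_left) hK
    inter_subset_right hm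
  obtain ⟨F, hF, hFS, hDF⟩ := hLa.exists_finite_sq_inter_closure_subset hLfin hS.approxSubgroup
    hSL hK hSK
  let _ : TopologicalSpace (Subgroup.closure S) := ⊥
  have : DiscreteTopology (Subgroup.closure S) := ⟨rfl⟩
  obtain ⟨E, _, _, hE, π, b, hpair, hb⟩ := h
  obtain ⟨R, hR⟩ := hpair.exists_bound
  -- Properness is only given for positive bounds, hence `max C 1`; in a discrete group compact
  -- means finite.
  have hbS : ∀ C : ℝ, {γ : Subgroup.closure S | (γ : G) ∈ S ∧ ‖b γ‖ ≤ C}.Finite := fun C =>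
    ((hb (max C 1) (by positivity)).finite_of_discrete).subset fun γ hγ =>
      subset_closure ⟨hγ.1, hγ.2.trans (le_max_left _ _)⟩
  -- The cocycle takes values in `L² ∩ Γ` rather than in `S`, so properness must first be enlarged
  -- through `L² ∩ Γ ⊆ S F`.
  have hbD := finite_setOf_norm_le_of_subset_mul hR (S := {γ | (γ : G) ∈ S})
    (D := {γ | (γ : G) ∈ L * L ∩ Subgroup.closure S}) (F := Subtype.val ⁻¹' F)
    (hF.preimage Subtype.val_injective.injOn) (fun γ hγ => by
      obtain ⟨s, hs, f, hf, hsf⟩ := hDF hγ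
      exact ⟨⟨s, Subgroup.subset_closure hs⟩, hs, ⟨f, hFS hf⟩, hf, Subtype.ext hsf⟩) hbS
  refine ⟨Lp E p m, inferInstance, inferInstance, hE.Lp m hp', hc.inducedRep hm p π,
    hc.inducedCocycle p b, hc.isPair hm hp' hpair, fun C _ => ?_⟩
  simpa using hc.isCompact_closure_inducedCocycle hm0 hbD C

end ApproxLattice

theorem theorem1p1 {G : Type*} [Group G] [TopologicalSpace G] [IsTopologicalGroup G]
    [LocallyCompactSpace G] [SecondCountableTopology G] [T2Space G]
    (𝓗 : ApproxLattice.HaagerupType) (p : ℝ≥0∞) (hp : 1 < p) (hp' : p < ∞)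
    (S L : Set G) (hS : ApproxLattice.IsUniformApproxLattice S)
    (hL : ApproxLattice.IsStrongUniformApproxLattice L) (hSL : S ⊆ L) :
    ApproxLattice.Has 𝓗 p G ↔ ApproxLattice.ApproxGroupHas 𝓗 p S :=
  ⟨ApproxLattice.approxGroupHas_of_has hS.delone.locFin,
    ApproxLattice.has_of_approxGroupHas hp.le hp'.ne hS hL hSL⟩
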